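/- Let $p\in\mathbb N$, $q\in\{1,2\}$, $M>0$, and $\mathcal B=\{\beta\in\mathbb R^p:\beta\ge 0,\ \|\beta\|_\infty\le M\}$. Let $\mu$ be a finite measure on $\mathbb R_+=[0,\infty)$ with $\mu((0,\infty))>0$ whose support is bounded and bounded away from zero. Put $h(z)=\int_0^\infty e^{-tz}\,\mu(dt)$, and let $\mathcal H$ be the reproducing kernel Hilbert space of real functions on $\mathbb R^p$ with kernel $k(x,x')=h(\|x-x'\|_q^q)$. Let $Q$ be a probability law of $(X,Y)\in\mathbb R^p\times\mathbb R$ with bounded support such that $\mathbb E_Q[Y]=0$ and $\mathrm{Var}_Q(X_l)>0$ for all $l\in[p]$. The signal set $S\subseteq[p]$ is the minimal set such that $\mathbb E_Q[Y|X]=\mathbb E_Q[Y|X_S]$ and $X_S\perp X_{S^c}$ under $Q$. Assume $S\ne\emptyset$. For $\lambda>0$ and $\beta\ge 0$ define $$F_\lambda^{\rm KRR}(\beta)=\min_{f\in\mathcal H}\ \tfrac12\,\mathbb E_Q\big[(Y-f(\beta^{1/q}\odot X))^2\big]+\tfrac{\lambda}{2}\|f\|_{\mathcal H}^2,$$ where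 $\beta^{1/q}\odot X$ is the vector with coordinates $\beta_i^{1/q}X_i$. A locally Lipschitz function $F$ on $\mathcal B$ is called self-penalizing with respect to a relatively open set $B\subseteq\mathcal B$ if 1. $F$ is differentiable on a subset $B^0$ that is dense in $B$, and there is $\kappa>0$ with $\mathrm{sign}(\beta_j)\,\partial_{\beta_j}F(\beta)\ge\kappa$ for all $j\notin S$ and all $\beta\in B^0$; and 2. $B$ contains a stationary point $\beta$ with $\mathrm{supp}(\beta)\subseteq S$, where stationary means $\beta \in \mathcal B$ and $0\in\partial F(\beta)+N_{\mathcal B}(\beta)$, with $\partial F$ the Clarke subdifferential of $F$ on $\mathcal B$ (the convex hull of the limits of gradients of $F$ at points of differentiability in the interior of $\mathcal B$ converging to $\beta$; the gradient, if $F$ is continuously differentiable on $\mathcal B$) and $N_{\mathcal B}$ the normal cone of $\mathcal B$. For $c,\delta,\lambda>0$ let $$B_{c,\delta,\lambda}=\Big\{\beta\in\mathcal B:\ F^{\rm KRR}_\lambda(0)-F^{\rm KRR}_\lambda(\beta)>c,\ \ \|\beta_{S^c}\|_1<\delta c^2\lambda^3\Big\}.$$ Then: (a) There are $c_0,\lambda_0>0$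 such that $B_{c,\delta,\lambda}\ne\emptyset$ for all $0<c\le c_0$, $0<\lambda\le\lambda_0$ and $\delta>0$. (b) There is $\delta_0>0$ such that for all $c>0$, $0<\delta\le\delta_0$ and $0<\lambda\le 1$ with $B_{c,\delta,\lambda}\neq\emptyset$, the objective $F^{\rm KRR}_\lambda$ is self-penalizing with respect to $B_{c,\delta,\lambda}$. -/

import Mathlib

open MeasureTheory ProbabilityTheory Filter Topology
open scoped NNReal Pointwise

namespace SelfPen

/-! ### The `ℓ_q`-type kernel and its reproducing kernel Hilbert space -/

/-- The function `h(z) = ∫_0^∞ e^{-tz} μ(dt)` attached to a finite measure `μ` on `ℝ₊`. -/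
noncomputable def laplaceFun (μ : Measure ℝ≥0) (z : ℝ) : ℝ :=
  ∫ t : ℝ≥0, Real.exp (-((t : ℝ) * z)) ∂μ

/-- The kernel `k(x, x') = h(‖x - x'‖_q ^ q)` on `ℝ^p`, as a matrix of (scalar) operators. -/
noncomputable def kernelMatrix (μ : Measure ℝ≥0) (q p : ℕ) :
    Matrix (Fin p → ℝ) (Fin p → ℝ) (ℝ →L[ℝ] ℝ) :=
  Matrix.of fun x y => laplaceFun μ (∑ i, |x i - y i| ^ q) • ContinuousLinearMap.id ℝ ℝ

theorem posSemidef_integral {X α : Type*} [MeasurableSpace α] (ν : Measure α)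
    (M : α → Matrix X X ℝ) (hM : ∀ a, (M a).PosSemidef)
    (hint : ∀ x y, Integrable (fun a => M a x y) ν) :
    (Matrix.of fun x y => ∫ a, M a x y ∂ν : Matrix X X ℝ).PosSemidef := by
  refine ⟨?_, fun c => ?_⟩
  · ext x y
    simp only [Matrix.conjTranspose_apply, Matrix.of_apply, star_trivial]
    exact integral_congr_ae (.of_forall fun a => by simpa using (hM a).1.apply x y)
  · have h : (c.sum fun i xi => c.sum fun j xj =>
        star xi * (Matrix.of fun x y => ∫ a, M a x y ∂ν : Matrix X X ℝ) i j * xj)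
        = ∫ a, (c.sum fun i xi => c.sum fun j xj => star xi * M a i j * xj) ∂ν := by
      simp only [Finsupp.sum, Matrix.of_apply]
      rw [integral_finsetSum]
      · refine Finset.sum_congr rfl fun i _ => ?_
        rw [integral_finsetSum]
        · refine Finset.sum_congr rfl fun j _ => ?_
          rw [integral_mul_const, integral_const_mul]
        · exact fun j _ => ((hint i j).const_mul _).mul_const _
      · exact fun i _ => integrable_finsetSum _ fun j _ =>
          ((hint i j).const_mul _).mul_const _
    rw [h]
    exact integral_nonneg fun a => (hM a).2 c

theorem posSemidef_rankOne {X : Type*} (φ : X → ℝ) :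
    (Matrix.of fun x y => φ x * φ y : Matrix X X ℝ).PosSemidef := by
  refine ⟨?_, fun c => ?_⟩
  · ext x y
    simp [mul_comm]
  · have h : (c.sum fun i xi => c.sum fun j xj =>
        star xi * (Matrix.of fun x y => φ x * φ y : Matrix X X ℝ) i j * xj)
        = (c.sum fun i xi => xi * φ i) ^ 2 := by
      simp only [Finsupp.sum, Matrix.of_apply, star_trivial, sq, Finset.sum_mul_sum]
      refine Finset.sum_congr rfl fun i _ => Finset.sum_congr rfl fun j _ => ?_
      ring
    rw [h]
    positivity

theorem posSemidef_exp_abs (t : ℝ) (ht : 0 ≤ t) :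
    (Matrix.of fun x y : ℝ => Real.exp (-(t * |x - y|)) : Matrix ℝ ℝ ℝ).PosSemidef := by
  set φ : ℝ → ℝ → ℝ := fun u x =>
    Real.exp (-(t * x)) * (Set.Ioc 0 (Real.exp (2 * t * x))).indicator (fun _ => (1 : ℝ)) u with hφ
  have hmul : ∀ x y u, φ u x * φ u y = (Real.exp (-(t * x)) * Real.exp (-(t * y))) *
      (Set.Ioc 0 (min (Real.exp (2 * t * x)) (Real.exp (2 * t * y)))).indicator
        (fun _ => (1 : ℝ)) u := by
    intro x y u
    have : Set.Ioc 0 (min (Real.exp (2 * t * x)) (Real.exp (2 * t * y)))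
        = Set.Ioc 0 (Real.exp (2 * t * x)) ∩ Set.Ioc 0 (Real.exp (2 * t * y)) := by
      rw [Set.Ioc_inter_Ioc]; simp
    rw [this]
    simp only [hφ, Set.indicator_apply, Set.mem_inter_iff]
    split_ifs <;> simp_all
  have key := posSemidef_integral (volume : Measure ℝ)
    (fun u => (Matrix.of fun x y => φ u x * φ u y : Matrix ℝ ℝ ℝ))
    (fun u => posSemidef_rankOne (φ u)) (fun x y => by
      simp only [Matrix.of_apply, hmul]
      refine Integrable.const_mul ?_ _
      refine (integrable_indicator_iff measurableSet_Ioc).2 ?_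
      simp)
  convert key using 1
  ext x y
  simp only [Matrix.of_apply, hmul]
  rw [integral_const_mul, integral_indicator measurableSet_Ioc]
  simp only [integral_const, smul_eq_mul, mul_one, MeasurableSet.univ, measureReal_restrict_apply,
    Set.univ_inter]
  rw [Real.volume_real_Ioc_of_le (by positivity), sub_zero, ← Real.exp_monotone.map_min,
    ← Real.exp_add, ← Real.exp_add]
  congr 1
  rcases le_total x y with hxy | hxy
  · rw [abs_of_nonpos (by linarith), min_eq_left (by nlinarith)]; ring
  · rw [abs_of_nonneg (by linarith), min_eq_right (by nlinarith)]; ring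

theorem posSemidef_exp_sq (t : ℝ) (ht : 0 ≤ t) :
    (Matrix.of fun x y : ℝ => Real.exp (-(t * |x - y| ^ 2)) : Matrix ℝ ℝ ℝ).PosSemidef := by
  rcases ht.eq_or_lt with rfl | ht
  · simpa using posSemidef_rankOne (fun _ : ℝ => (1 : ℝ))
  set κ : ℝ := (√(Real.pi / (4 * t)))⁻¹ with hκ
  have hκ0 : √(Real.pi / (4 * t)) ≠ 0 := by positivity
  set φ : ℝ → ℝ → ℝ := fun u x => √κ * Real.exp (-(2 * t * (x - u) ^ 2)) with hφ
  have hmul : ∀ x y u, φ u x * φ u y = (κ * Real.exp (-(t * |x - y| ^ 2))) *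
      Real.exp (-(4 * t) * (u - (x + y) / 2) ^ 2) := by
    intro x y u
    have : φ u x * φ u y = (√κ * √κ) *
      (Real.exp (-(2 * t * (x - u) ^ 2)) * Real.exp (-(2 * t * (y - u) ^ 2))) := by
      simp only [hφ]; ring
    rw [this, Real.mul_self_sqrt (by positivity), mul_assoc κ, ← Real.exp_add, ← Real.exp_add,
      sq_abs]
    congr 2
    ring
  have key := posSemidef_integral (volume : Measure ℝ)
    (fun u => (Matrix.of fun x y => φ u x * φ u y : Matrix ℝ ℝ ℝ))
    (fun u => posSemidef_rankOne (φ u)) (fun x y => by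
      simp only [Matrix.of_apply, hmul]
      refine Integrable.const_mul ?_ _
      exact (integrable_exp_neg_mul_sq (b := 4 * t) (by positivity)).comp_sub_right ((x + y) / 2))
  convert key using 1
  ext x y
  simp only [Matrix.of_apply, hmul]
  rw [integral_const_mul,
    integral_sub_right_eq_self (fun u => Real.exp (-(4 * t) * u ^ 2)) ((x + y) / 2),
    integral_gaussian, hκ]
  field_simp

theorem posSemidef_exp_sum (q p : ℕ) (hq : q = 1 ∨ q = 2) (t : ℝ) (ht : 0 ≤ t)
    (s : Finset (Fin p)) :
    (Matrix.of fun x y : Fin p → ℝ => Real.exp (-(t * ∑ i ∈ s, |x i - y i| ^ q)) :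
      Matrix _ _ ℝ).PosSemidef := by
  classical
  induction s using Finset.induction_on with
  | empty => simpa using posSemidef_rankOne (fun _ : Fin p → ℝ => (1 : ℝ))
  | insert i s his ih =>
    have h1 : (Matrix.of fun x y : ℝ => Real.exp (-(t * |x - y| ^ q)) : Matrix ℝ ℝ ℝ).PosSemidef := by
      rcases hq with rfl | rfl
      · simpa using posSemidef_exp_abs t ht
      · exact posSemidef_exp_sq t ht
    have h2 := (h1.submatrix (fun x : Fin p → ℝ => x i)).hadamard ih
    have h3 : (Matrix.of fun x y : Fin p → ℝ =>
        Real.exp (-(t * ∑ j ∈ insert i s, |x j - y j| ^ q)) : Matrix _ _ ℝ)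
        = Matrix.hadamard
          ((Matrix.of fun x y : ℝ => Real.exp (-(t * |x - y| ^ q)) : Matrix ℝ ℝ ℝ).submatrix
            (fun x : Fin p → ℝ => x i) (fun x : Fin p → ℝ => x i))
          (Matrix.of fun x y : Fin p → ℝ => Real.exp (-(t * ∑ j ∈ s, |x j - y j| ^ q))) := by
      ext x y
      rw [Matrix.hadamard_apply, Matrix.submatrix_apply, Matrix.of_apply, Matrix.of_apply,
        Matrix.of_apply, Finset.sum_insert his, ← Real.exp_add]
      congr 1
      ring
    rw [h3]
    exact h2

theorem posSemidef_laplaceFun (μ : Measure ℝ≥0) [IsFiniteMeasure μ] (q p : ℕ)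
    (hq : q = 1 ∨ q = 2) :
    (Matrix.of fun x y : Fin p → ℝ => laplaceFun μ (∑ i, |x i - y i| ^ q) :
      Matrix _ _ ℝ).PosSemidef := by
  refine posSemidef_integral μ
    (fun t => (Matrix.of fun x y : Fin p → ℝ =>
      Real.exp (-((t : ℝ) * ∑ i, |x i - y i| ^ q)) : Matrix _ _ ℝ))
    (fun t => posSemidef_exp_sum q p hq t t.2 Finset.univ) (fun x y => ?_)
  refine Integrable.of_bound (C := 1) ?_ (.of_forall fun t => ?_)
  · simp only [Matrix.of_apply]
    exact (by fun_prop : Measurable fun t : ℝ≥0 =>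
      Real.exp (-((t : ℝ) * ∑ i, |x i - y i| ^ q))).aestronglyMeasurable
  · simp only [Matrix.of_apply, Real.norm_eq_abs, Real.abs_exp, Real.exp_le_one_iff,
      Left.neg_nonpos_iff]
    positivity

/-- The kernel is positive semidefinite, so that it has a reproducing kernel Hilbert space. -/
instance kernelMatrix_posSemidef (μ : Measure ℝ≥0) [IsFiniteMeasure μ] (q p : ℕ)
    [hq : Fact (q = 1 ∨ q = 2)] : Fact (kernelMatrix μ q p).PosSemidef := by
  have htfae := (RKHS.posSemidef_tfae (𝕜 := ℝ) (K := kernelMatrix μ q p)).out 0 2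
  refine ⟨htfae.2 ⟨?_, fun v => ?_⟩⟩
  · ext x y
    have h1 : star (ContinuousLinearMap.id ℝ ℝ) = ContinuousLinearMap.id ℝ ℝ :=
      star_one (ℝ →L[ℝ] ℝ)
    simp [kernelMatrix, Matrix.conjTranspose_apply, abs_sub_comm, h1]
  · have h := (posSemidef_laplaceFun μ q p hq.out).2 v
    have h2 : ∀ a b : ℝ, 0 ≤ a → a = b → 0 ≤ RCLike.re b := fun a b ha hab => by
      subst hab; simpa using ha
    refine h2 _ _ h ?_
    refine Finsupp.sum_congr fun x _ => Finsupp.sum_congr fun y _ => ?_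
    simp [kernelMatrix, abs_sub_comm (x _) (y _)]
    ring

/-- The reproducing kernel Hilbert space `H` of real functions on `ℝ^p` with kernel
`k(x, x') = h(‖x - x'‖_q ^ q)`. -/
abbrev KernelSpace (μ : Measure ℝ≥0) [IsFiniteMeasure μ] (q p : ℕ) [Fact (q = 1 ∨ q = 2)] :
    Type :=
  RKHS.OfKernel (kernelMatrix μ q p)

/-! ### The objective -/

/-- The rescaled feature vector `β^{1/q} ⊙ x`. -/
noncomputable def rescale (q : ℕ) {p : ℕ} (β x : Fin p → ℝ) : Fin p → ℝ :=
  fun i => β i ^ (1 / (q : ℝ)) * x i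

/-- The kernel ridge regression objective
`F_λ(β; Q) = min_{f ∈ H} (1/2) E_Q[(Y - f(β^{1/q} ⊙ X))²] + (λ/2) ‖f‖_H²`,
where `Q` is the joint law of `(X, Y)`. -/
noncomputable def krrObjective (μ : Measure ℝ≥0) [IsFiniteMeasure μ] (q : ℕ) {p : ℕ}
    [Fact (q = 1 ∨ q = 2)] (Q : Measure ((Fin p → ℝ) × ℝ)) (lam : ℝ) (β : Fin p → ℝ) : ℝ :=
  ⨅ f : KernelSpace μ q p,
    ((1 / 2) * ∫ z, (z.2 - f (rescale q β z.1)) ^ 2 ∂Q + lam / 2 * ‖f‖ ^ 2)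

/-- The feasible set `{β : β ≥ 0, ‖β‖_∞ ≤ M}`. -/
def feasibleSet (p : ℕ) (M : ℝ) : Set (Fin p → ℝ) :=
  {β | (∀ i, 0 ≤ β i) ∧ ∀ i, |β i| ≤ M}

/-! ### Assumptions and the signal set -/

/-- The measure `μ` charges `(0, ∞)`, and its support is bounded and bounded away from zero. -/
structure KernelAssumption (μ : Measure ℝ≥0) : Prop where
  pos : 0 < μ (Set.Ioi 0)
  support_bounded : ∃ m M : ℝ≥0, 0 < m ∧ μ.support ⊆ Set.Icc m M

/-- `E_Q[Y] = 0`, the support of `(X, Y)` is bounded, and each coordinate of `X` has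
non-vanishing variance. -/
structure DistributionAssumption {p : ℕ} (Q : Measure ((Fin p → ℝ) × ℝ)) : Prop where
  centered : ∫ z, z.2 ∂Q = 0
  bounded : ∃ MX MY : ℝ, ∀ᵐ z ∂Q, (∀ i, |z.1 i| ≤ MX) ∧ |z.2| ≤ MY
  variance_pos : ∀ l, 0 < variance (fun z : (Fin p → ℝ) × ℝ => z.1 l) Q

/-- The subvector `X_T`. -/
def subvector {p : ℕ} (T : Finset (Fin p)) (z : (Fin p → ℝ) × ℝ) : T → ℝ :=
  fun i => z.1 i

/-- `E_Q[Y | X] = E_Q[Y | X_T]` and `X_T ⟂ X_{Tᶜ}` under `Q`. -/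
def IsSufficient {p : ℕ} (Q : Measure ((Fin p → ℝ) × ℝ)) (T : Finset (Fin p)) : Prop :=
  (Q[Prod.snd | MeasurableSpace.comap (Prod.fst : (Fin p → ℝ) × ℝ → (Fin p → ℝ)) inferInstance]
    =ᵐ[Q] Q[Prod.snd | MeasurableSpace.comap (subvector T) inferInstance]) ∧
  IndepFun (subvector T) (subvector Tᶜ) Q

/-- The signal set: the minimal `S` such that `E_Q[Y | X] = E_Q[Y | X_S]` and
`X_S ⟂ X_{Sᶜ}` under `Q`. -/
def IsSignalSet {p : ℕ} (Q : Measure ((Fin p → ℝ) × ℝ)) (S : Finset (Fin p)) : Prop :=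
  Minimal (IsSufficient Q) S

/-! ### Stationarity and self-penalization -/

/-- The partial derivative `∂_{β_j} F(β)` of a function on `D` (at a boundary point of `D`, it is
taken along `D`). -/
noncomputable def partialDeriv {p : ℕ} (F : (Fin p → ℝ) → ℝ) (D : Set (Fin p → ℝ))
    (β : Fin p → ℝ) (j : Fin p) : ℝ :=
  fderivWithin ℝ F D β (Pi.single j 1)

/-- The Clarke subdifferential at `β` of a locally Lipschitz function on `D` (a convex set with
interior points): the convex hull of all limits of gradients at points of differentiability,
interior to `D`, that converge to `β`. -/
def clarkeSubdifferential {p : ℕ} (F : (Fin p → ℝ) → ℝ) (D : Set (Fin p → ℝ))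
    (β : Fin p → ℝ) : Set (Fin p → ℝ) :=
  convexHull ℝ {g | ∃ b : ℕ → Fin p → ℝ,
    (∀ k, b k ∈ interior D ∧ DifferentiableAt ℝ F (b k)) ∧
    Tendsto b atTop (𝓝 β) ∧ Tendsto (fun k => partialDeriv F D (b k)) atTop (𝓝 g)}

/-- The normal cone of the convex set `D` at `β`. -/
def normalCone {p : ℕ} (D : Set (Fin p → ℝ)) (β : Fin p → ℝ) : Set (Fin p → ℝ) :=
  {v | ∀ γ ∈ D, ∑ i, v i * (γ i - β i) ≤ 0}

/-- The set of Clarke stationary points of `min_{β ∈ D} F(β)`. -/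
def stationaryPoints {p : ℕ} (F : (Fin p → ℝ) → ℝ) (D : Set (Fin p → ℝ)) :
    Set (Fin p → ℝ) :=
  {β ∈ D | (0 : Fin p → ℝ) ∈ clarkeSubdifferential F D β + normalCone D β}

/-- The objective `F` on the feasible set `D` is self-penalizing with respect to `B`, for the
signal set `S`. -/
structure SelfPenalizing {p : ℕ} (S : Finset (Fin p)) (D : Set (Fin p → ℝ))
    (F : (Fin p → ℝ) → ℝ) (B : Set (Fin p → ℝ)) : Prop where
  locallyLipschitz : LocallyLipschitzOn D F
  relatively_open : ∃ U : Set (Fin p → ℝ), IsOpen U ∧ B = U ∩ D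
  gradient_bound : ∃ B₀ ⊆ B, B ⊆ closure B₀ ∧
    (∀ β ∈ B₀, DifferentiableWithinAt ℝ F D β) ∧
    ∃ κ > 0, ∀ j ∉ S, ∀ β ∈ B₀, κ ≤ Real.sign (β j) * partialDeriv F D β j
  exists_stationary : ∃ β ∈ B, β ∈ stationaryPoints F D ∧ Function.support β ⊆ S

/-- The set `B_{c,δ,λ} = {β ∈ D : F(0) - F(β) > c, ‖β_{Sᶜ}‖₁ < δ c² λ³}`. -/
def levelSet {p : ℕ} (S : Finset (Fin p)) (D : Set (Fin p → ℝ)) (F : (Fin p → ℝ) → ℝ)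
    (c δ lam : ℝ) : Set (Fin p → ℝ) :=
  {β ∈ D | F 0 - F β > c ∧ ∑ j ∈ Sᶜ, |β j| < δ * c ^ 2 * lam ^ 3}

end SelfPen

open SelfPen

/-!
Let `r` be the residual of the kernel ridge regression with weights `β`. The optimal value is
`½ E[Y r]`, and `λ (Y - r)` is the average `E'[k r']` over an independent copy `(X', Y')` of the
data, so by the envelope theorem `∂_j F = -(1 / 2λ) E E'[(∂_j k) r r']`, where `-∂_j k` is
`|X_j - X'_j|^q` times the kernel of the measure `t μ(dt)`.

If `β` vanishes off `S`, then `k` and `r` do not involve the noise covariates, and by independence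
of signal and noise, for `j ∉ S`, this expectation factors into `E E'|X_j - X'_j|^q` and the energy
of `r` for `t μ(dt)`. Since `μ` is supported away from zero that energy dominates the energy for
`μ`, which by the Cauchy–Schwarz inequality is at least of order `λ² c²` once the objective is `c`
below its value at zero. The gradient is Lipschitz, so moving the noise weights by less than
`δ c² λ³` preserves positivity of the noise derivatives. A minimizer of the objective among the
weights that vanish off `S` is then stationary on the whole feasible set.

If no weights supported in `S` improved on the value at zero, `Y` would be orthogonal to every
`h(∑ b_i |y_i - X_i|^q)` with small `b ≥ 0` on `S`. Differentiating in `b` at `b = 0` makes `Y`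
orthogonal to all polynomials in `|y_i - X_i|^q`, hence, for `y` to the left of the support, to all
continuous functions of `X_S`. Then `E[Y | X_S] = 0`, so `∅` is sufficient, and `S` is not minimal.
-/

namespace SelfPen

/-! ### Moments of the Laplace transform -/

section LaplaceMoment

/-- The moments `∫ tⁿ e^{-tz} μ(dt)`: up to the sign `(-1)ⁿ`, the derivatives of `laplaceFun μ`. -/
noncomputable def laplaceMoment (μ : Measure ℝ≥0) (n : ℕ) (z : ℝ) : ℝ :=
  ∫ t : ℝ≥0, (t : ℝ) ^ n * Real.exp (-((t : ℝ) * z)) ∂μ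

theorem laplaceMoment_zero (μ : Measure ℝ≥0) : laplaceMoment μ 0 = laplaceFun μ := by
  ext z
  simp [laplaceMoment, laplaceFun]

theorem laplaceMoment_nonneg (μ : Measure ℝ≥0) (n : ℕ) (z : ℝ) : 0 ≤ laplaceMoment μ n z :=
  integral_nonneg fun t => by positivity

theorem norm_pow_mul_exp_neg_mul_le (n : ℕ) {t : ℝ≥0} {T R z : ℝ} (ht : (t : ℝ) ≤ T)
    (hz : |z| ≤ R) :
    ‖(t : ℝ) ^ n * Real.exp (-((t : ℝ) * z))‖ ≤ T ^ n * Real.exp (T * R) := by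
  have hT : 0 ≤ T := t.2.trans ht
  rw [norm_mul, norm_pow, NNReal.norm_eq, Real.norm_eq_abs, Real.abs_exp]
  gcongr
  calc -((t : ℝ) * z) ≤ |(t : ℝ) * z| := neg_le_abs _
    _ = t * |z| := by rw [abs_mul, NNReal.abs_eq]
    _ ≤ T * R := by gcongr

theorem KernelAssumption.ae_mem_Icc {μ : Measure ℝ≥0} (hμ : KernelAssumption μ) :
    ∃ m T : ℝ, 0 < m ∧ ∀ᵐ t : ℝ≥0 ∂μ, m ≤ (t : ℝ) ∧ (t : ℝ) ≤ T := by
  obtain ⟨m, T, hm, hs⟩ := hμ.support_bounded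
  refine ⟨m, T, by exact_mod_cast hm, ?_⟩
  filter_upwards [Measure.support_mem_ae (μ := μ)] with t ht
  exact ⟨by exact_mod_cast (hs ht).1, by exact_mod_cast (hs ht).2⟩

variable {μ : Measure ℝ≥0} [IsFiniteMeasure μ] {T : ℝ} (hT : ∀ᵐ t : ℝ≥0 ∂μ, (t : ℝ) ≤ T)
include hT

theorem integrable_laplaceMoment (n : ℕ) (z : ℝ) :
    Integrable (fun t : ℝ≥0 => (t : ℝ) ^ n * Real.exp (-((t : ℝ) * z))) μ :=
  .of_bound (by fun_prop : Measurable _).aestronglyMeasurable _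
    (hT.mono fun _ ht => norm_pow_mul_exp_neg_mul_le n ht le_rfl)

theorem hasDerivAt_laplaceMoment (n : ℕ) (z : ℝ) :
    HasDerivAt (laplaceMoment μ n) (-laplaceMoment μ (n + 1) z) z := by
  have abs_le : ∀ x ∈ Metric.ball z 1, |x| ≤ |z| + 1 := fun x hx => by
    rw [Metric.mem_ball, Real.dist_eq] at hx
    linarith [abs_sub_abs_le_abs_sub x z]
  have integrand_deriv : ∀ (t : ℝ≥0) (x : ℝ),
      HasDerivAt (fun x => (t : ℝ) ^ n * Real.exp (-((t : ℝ) * x)))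
        (-((t : ℝ) ^ (n + 1) * Real.exp (-((t : ℝ) * x)))) x := fun t x => by
    have hexponent : HasDerivAt (fun x : ℝ => -((t : ℝ) * x)) (-(t : ℝ)) x := by
      simpa using ((hasDerivAt_id' x).const_mul (t : ℝ)).fun_neg
    exact (hexponent.exp.const_mul ((t : ℝ) ^ n)).congr_deriv (by ring)
  refine (hasDerivAt_integral_of_dominated_loc_of_deriv_le (μ := μ) (x₀ := z)
    (bound := fun _ => T ^ (n + 1) * Real.exp (T * (|z| + 1))) (Metric.ball_mem_nhds z one_pos)
    (.of_forall fun x => (by fun_prop : Measurable _).aestronglyMeasurable)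
    (integrable_laplaceMoment hT n z) (by fun_prop : Measurable _).aestronglyMeasurable
    (hT.mono fun t ht x hx => ?_) (integrable_const _)
    (.of_forall fun t x _ => integrand_deriv t x)).2.congr_deriv (integral_neg _)
  exact (norm_neg _).trans_le (norm_pow_mul_exp_neg_mul_le _ ht (abs_le x hx))

theorem continuous_laplaceMoment (n : ℕ) : Continuous (laplaceMoment μ n) :=
  continuous_iff_continuousAt.2 fun z => (hasDerivAt_laplaceMoment hT n z).continuousAt

theorem laplaceMoment_le_at_zero (n : ℕ) {z : ℝ} (hz : 0 ≤ z) :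
    laplaceMoment μ n z ≤ laplaceMoment μ n 0 := by
  refine integral_mono (integrable_laplaceMoment hT n z) (integrable_laplaceMoment hT n 0) ?_
  intro t
  dsimp only
  gcongr

theorem abs_laplaceMoment_sub_le (n : ℕ) {a b : ℝ} (ha : 0 ≤ a) (hb : 0 ≤ b) :
    |laplaceMoment μ n b - laplaceMoment μ n a| ≤ laplaceMoment μ (n + 1) 0 * |b - a| := by
  refine (convex_Ici (0 : ℝ)).norm_image_sub_le_of_norm_hasDerivWithin_le
    (fun x _ => (hasDerivAt_laplaceMoment hT n x).hasDerivWithinAt) (fun x hx => ?_) ha hb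
  rw [norm_neg, Real.norm_eq_abs, abs_of_nonneg (laplaceMoment_nonneg _ _ _)]
  exact laplaceMoment_le_at_zero hT _ hx

theorem abs_laplaceMoment_sub_add_le (n : ℕ) {a b : ℝ} (ha : 0 ≤ a) (hb : 0 ≤ b) :
    |laplaceMoment μ n b - laplaceMoment μ n a + laplaceMoment μ (n + 1) a * (b - a)| ≤
      laplaceMoment μ (n + 2) 0 * (b - a) ^ 2 := by
  have mean_value := (convex_uIcc a b).norm_image_sub_le_of_norm_hasDerivWithin_le
    (f := fun x => laplaceMoment μ n x + laplaceMoment μ (n + 1) a * x)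
    (f' := fun x => -laplaceMoment μ (n + 1) x + laplaceMoment μ (n + 1) a)
    (C := laplaceMoment μ (n + 2) 0 * |b - a|) (x := a) (y := b)
    (fun x _ => by
      simpa using ((hasDerivAt_laplaceMoment hT n x).fun_add
        ((hasDerivAt_id' x).const_mul (laplaceMoment μ (n + 1) a))).hasDerivWithinAt)
    (fun x hx => by
      have hx0 : 0 ≤ x := (le_min ha hb).trans hx.1
      rw [neg_add_eq_sub, Real.norm_eq_abs]
      refine (abs_laplaceMoment_sub_le hT (n + 1) hx0 ha).trans ?_
      rw [abs_sub_comm]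
      exact mul_le_mul_of_nonneg_left (Set.abs_sub_left_of_mem_uIcc hx)
        (laplaceMoment_nonneg _ _ _))
    Set.left_mem_uIcc Set.right_mem_uIcc
  rw [Real.norm_eq_abs, Real.norm_eq_abs, mul_assoc, ← sq, sq_abs] at mean_value
  convert mean_value using 2
  ring

theorem laplaceMoment_pos (hpos : 0 < μ (Set.Ioi 0)) (n : ℕ) (z : ℝ) :
    0 < laplaceMoment μ n z := by
  refine (integral_pos_iff_support_of_nonneg (fun t => by positivity)
    (integrable_laplaceMoment hT n z)).2 (hpos.trans_le (measure_mono fun t ht => ?_))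
  have : (0 : ℝ) < t := by exact_mod_cast ht
  simp only [Function.mem_support]
  positivity

end LaplaceMoment

/-! ### Ridge regression and its residual -/

section Ridge

open scoped InnerProductSpace

variable {Ω : Type*} [MeasurableSpace Ω] {Q : Measure Ω}

section KernelForm

/-- The bilinear form `∫∫ r(z) s(z') κ(z, z') Q(dz) Q(dz')` of a kernel `κ` on `(Ω, Q)`. It is used
for bounded `r`, `s` and `κ`, where all the integrals converge. -/
noncomputable def kernelForm (Q : Measure Ω) (κ : Ω × Ω → ℝ) (r s : Ω → ℝ) : ℝ :=
  ∫ w, r w.1 * s w.2 * κ w ∂(Q.prod Q)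

theorem memLp_top_mul {f g : Ω → ℝ} (hf : MemLp f ⊤ Q) (hg : MemLp g ⊤ Q) :
    MemLp (fun z => f z * g z) ⊤ Q :=
  hg.mul hf

theorem kernelForm_const_mul_left (κ : Ω × Ω → ℝ) (c : ℝ) (r s : Ω → ℝ) :
    kernelForm Q κ (fun z => c * r z) s = c * kernelForm Q κ r s := by
  simp only [kernelForm, mul_assoc, integral_const_mul]

theorem kernelForm_const_mul_right (κ : Ω × Ω → ℝ) (c : ℝ) (r s : Ω → ℝ) :
    kernelForm Q κ r (fun z => c * s z) = c * kernelForm Q κ r s := by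
  simp only [kernelForm, mul_left_comm _ c, mul_assoc, integral_const_mul]

theorem kernelForm_comm [SFinite Q] {κ : Ω × Ω → ℝ} (hsymm : ∀ w, κ w.swap = κ w)
    (r s : Ω → ℝ) : kernelForm Q κ r s = kernelForm Q κ s r := by
  rw [kernelForm, ← integral_prod_swap]
  simp only [hsymm, Prod.fst_swap, Prod.snd_swap, mul_comm (r _), kernelForm]

variable [IsFiniteMeasure Q] {κ κ' : Ω × Ω → ℝ} {r r' s s' : Ω → ℝ}

theorem integrable_kernelForm (hκ : MemLp κ ⊤ (Q.prod Q)) (hr : MemLp r ⊤ Q)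
    (hs : MemLp s ⊤ Q) :
    Integrable (fun w : Ω × Ω => r w.1 * s w.2 * κ w) (Q.prod Q) :=
  (memLp_top_mul (memLp_top_mul (hr.comp_fst Q) (hs.comp_snd Q)) hκ).integrable le_top

theorem kernelForm_eq_integral_integral (hκ : MemLp κ ⊤ (Q.prod Q)) (hr : MemLp r ⊤ Q)
    (hs : MemLp s ⊤ Q) :
    kernelForm Q κ r s = ∫ z, r z * ∫ z', s z' * κ (z, z') ∂Q ∂Q := by
  rw [kernelForm, integral_prod _ (integrable_kernelForm hκ hr hs)]
  simp only [mul_assoc, integral_const_mul]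

theorem kernelForm_sub_left (hκ : MemLp κ ⊤ (Q.prod Q)) (hr : MemLp r ⊤ Q)
    (hr' : MemLp r' ⊤ Q) (hs : MemLp s ⊤ Q) :
    kernelForm Q κ (fun z => r z - r' z) s = kernelForm Q κ r s - kernelForm Q κ r' s := by
  simp only [kernelForm, sub_mul]
  exact integral_sub (integrable_kernelForm hκ hr hs) (integrable_kernelForm hκ hr' hs)

theorem kernelForm_sub_right (hκ : MemLp κ ⊤ (Q.prod Q)) (hr : MemLp r ⊤ Q)
    (hs : MemLp s ⊤ Q) (hs' : MemLp s' ⊤ Q) :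
    kernelForm Q κ r (fun z => s z - s' z) = kernelForm Q κ r s - kernelForm Q κ r s' := by
  simp only [kernelForm, mul_sub, sub_mul]
  exact integral_sub (integrable_kernelForm hκ hr hs) (integrable_kernelForm hκ hr hs')

theorem kernelForm_kernel_sub (hκ : MemLp κ ⊤ (Q.prod Q)) (hκ' : MemLp κ' ⊤ (Q.prod Q))
    (hr : MemLp r ⊤ Q) (hs : MemLp s ⊤ Q) :
    kernelForm Q (fun w => κ w - κ' w) r s = kernelForm Q κ r s - kernelForm Q κ' r s := by
  simp only [kernelForm, mul_sub]
  exact integral_sub (integrable_kernelForm hκ hr hs) (integrable_kernelForm hκ' hr hs)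

theorem abs_kernelForm_le {C : ℝ} (hκ : ∀ᵐ w ∂(Q.prod Q), |κ w| ≤ C) (hr : MemLp r ⊤ Q)
    (hs : MemLp s ⊤ Q) :
    |kernelForm Q κ r s| ≤ C * ((∫ z, |r z| ∂Q) * ∫ z, |s z| ∂Q) := by
  have hint : Integrable (fun w : Ω × Ω => |r w.1| * |s w.2|) (Q.prod Q) :=
    (memLp_top_mul (hr.comp_fst Q).abs (hs.comp_snd Q).abs).integrable le_top
  calc |kernelForm Q κ r s|
      ≤ ∫ w : Ω × Ω, C * (|r w.1| * |s w.2|) ∂(Q.prod Q) := by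
        rw [kernelForm, ← Real.norm_eq_abs]
        refine norm_integral_le_of_norm_le (hint.const_mul C) ?_
        filter_upwards [hκ] with w hw
        rw [Real.norm_eq_abs, abs_mul, abs_mul, mul_comm]
        exact mul_le_mul_of_nonneg_right hw (by positivity)
    _ = C * ((∫ z, |r z| ∂Q) * ∫ z, |s z| ∂Q) := by
        rw [integral_const_mul]
        exact congrArg (C * ·) (integral_prod_mul (L := ℝ) (fun z => |r z|) fun z => |s z|)

theorem abs_kernelForm_sub_le {K ε : ℝ} (hκ : MemLp κ ⊤ (Q.prod Q))
    (hκ' : MemLp κ' ⊤ (Q.prod Q)) (hK : ∀ᵐ w ∂(Q.prod Q), |κ' w| ≤ K)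
    (hε : ∀ᵐ w ∂(Q.prod Q), |κ' w - κ w| ≤ ε) (hr : MemLp r ⊤ Q) (hr' : MemLp r' ⊤ Q)
    (hs : MemLp s ⊤ Q) (hs' : MemLp s' ⊤ Q) :
    |kernelForm Q κ' r' s' - kernelForm Q κ r s| ≤
      K * ((∫ z, |r' z - r z| ∂Q) * ∫ z, |s' z| ∂Q) +
        K * ((∫ z, |r z| ∂Q) * ∫ z, |s' z - s z| ∂Q) +
        ε * ((∫ z, |r z| ∂Q) * ∫ z, |s z| ∂Q) := by
  have telescope : kernelForm Q κ' r' s' - kernelForm Q κ r s =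
      kernelForm Q κ' (fun z => r' z - r z) s' + kernelForm Q κ' r (fun z => s' z - s z) +
        kernelForm Q (fun w => κ' w - κ w) r s := by
    rw [kernelForm_sub_left hκ' hr' hr hs', kernelForm_sub_right hκ' hr hs' hs,
      kernelForm_kernel_sub hκ' hκ hr hs]
    ring
  rw [telescope]
  exact (abs_add_three _ _ _).trans (add_le_add_three (abs_kernelForm_le hK (hr'.sub hr) hs')
    (abs_kernelForm_le hK hr (hs'.sub hs)) (abs_kernelForm_le hε hr hs))

end KernelForm

section PosSemidefKernel

/-- A bounded symmetric kernel on `(Ω, Q)` whose form is nonnegative on bounded functions. -/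
structure IsPosSemidefKernel (Q : Measure Ω) (κ : Ω × Ω → ℝ) : Prop where
  memLp : MemLp κ ⊤ (Q.prod Q)
  symm : ∀ w, κ w.swap = κ w
  nonneg : ∀ r, MemLp r ⊤ Q → 0 ≤ kernelForm Q κ r r

theorem IsPosSemidefKernel.sq_kernelForm_le [IsFiniteMeasure Q] {κ : Ω × Ω → ℝ}
    (hκ : IsPosSemidefKernel Q κ) {r s : Ω → ℝ} (hr : MemLp r ⊤ Q) (hs : MemLp s ⊤ Q) :
    kernelForm Q κ r s ^ 2 ≤ kernelForm Q κ r r * kernelForm Q κ s s := by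
  have quadratic_nonneg : ∀ t : ℝ, 0 ≤ kernelForm Q κ s s * (t * t) +
      (-2 * kernelForm Q κ r s) * t + kernelForm Q κ r r := fun t => by
    have hts : MemLp (fun z => t * s z) ⊤ Q := hs.const_mul t
    have hdiff : MemLp (fun z => r z - t * s z) ⊤ Q := hr.sub hts
    have h := hκ.nonneg _ hdiff
    rw [kernelForm_sub_left hκ.memLp hr hts hdiff, kernelForm_sub_right hκ.memLp hr hr hts,
      kernelForm_sub_right hκ.memLp hts hr hts, kernelForm_const_mul_left,
      kernelForm_const_mul_left, kernelForm_const_mul_right, kernelForm_const_mul_right,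
      kernelForm_comm hκ.symm s r] at h
    linarith
  have h := discrim_le_zero quadratic_nonneg
  rw [discrim] at h
  linarith

end PosSemidefKernel

section RidgeResidual

/-- `r = Y - f` solves the Euler equation `lam (Y - r) = κ r` of kernel ridge regression with
response `Y` and regularization `lam`, in weak form. Only the residual `r`, and not the minimizer
`f`, occurs, so that residuals of different kernels can be compared. -/
structure IsRidgeResidual (Q : Measure Ω) (κ : Ω × Ω → ℝ) (Y : Ω → ℝ) (lam : ℝ)
    (r : Ω → ℝ) : Prop where
  memLp : MemLp r ⊤ Q
  euler : ∀ s, MemLp s ⊤ Q →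
    lam * ∫ z, s z * r z ∂Q + kernelForm Q κ s r = lam * ∫ z, s z * Y z ∂Q

theorem sq_integral_abs_le [IsProbabilityMeasure Q] {f : Ω → ℝ} (hf : MemLp f ⊤ Q) :
    (∫ z, |f z| ∂Q) ^ 2 ≤ ∫ z, f z * f z ∂Q := by
  have h := variance_nonneg |f| Q
  rw [variance_eq_sub (hf.abs.mono_exponent le_top)] at h
  simp only [Pi.pow_apply, Pi.abs_apply, sq_abs] at h
  simp only [← sq]
  linarith

namespace IsRidgeResidual

variable {κ κ' : Ω × Ω → ℝ} {Y r r' : Ω → ℝ} {lam : ℝ}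

theorem integral_mul_self_le (hr : IsRidgeResidual Q κ Y lam r) (hκ : IsPosSemidefKernel Q κ)
    (hlam : 0 < lam) : ∫ z, r z * r z ∂Q ≤ ∫ z, r z * Y z ∂Q :=
  le_of_mul_le_mul_left (by linarith [hr.euler r hr.memLp, hκ.nonneg r hr.memLp]) hlam

theorem integral_mul_sub_eq [SFinite Q] (hr : IsRidgeResidual Q κ Y lam r)
    (hr' : IsRidgeResidual Q κ' Y lam r') (hsymm : ∀ w, κ w.swap = κ w) :
    lam * (∫ z, r' z * Y z ∂Q - ∫ z, r z * Y z ∂Q) =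
      kernelForm Q κ r r' - kernelForm Q κ' r r' := by
  have h := hr.euler r' hr'.memLp
  rw [kernelForm_comm hsymm] at h
  have h' := hr'.euler r hr.memLp
  simp only [mul_comm (r' _) (r _)] at h
  linarith

variable [IsProbabilityMeasure Q]

theorem integral_abs_le (hr : IsRidgeResidual Q κ Y lam r) (hκ : IsPosSemidefKernel Q κ)
    (hlam : 0 < lam) {C : ℝ} (hC : 0 ≤ C) (hY : ∀ᵐ z ∂Q, |Y z| ≤ C) : ∫ z, |r z| ∂Q ≤ C := by
  have cross_le : ∫ z, r z * Y z ∂Q ≤ (∫ z, |r z| ∂Q) * C := by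
    rw [← integral_mul_const]
    refine (Real.le_norm_self _).trans (norm_integral_le_of_norm_le
      ((hr.memLp.abs.integrable le_top).mul_const C) ?_)
    filter_upwards [hY] with z hz
    rw [Real.norm_eq_abs, abs_mul]
    exact mul_le_mul_of_nonneg_left hz (abs_nonneg _)
  have sq_le := ((sq_integral_abs_le hr.memLp).trans (hr.integral_mul_self_le hκ hlam)).trans
    cross_le
  by_contra! hlt
  nlinarith

theorem integral_abs_sub_le (hr : IsRidgeResidual Q κ Y lam r)
    (hr' : IsRidgeResidual Q κ' Y lam r') (hκ : MemLp κ ⊤ (Q.prod Q))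
    (hκ' : IsPosSemidefKernel Q κ') (hlam : 0 < lam) {ε : ℝ} (hε₀ : 0 ≤ ε)
    (hε : ∀ᵐ w ∂(Q.prod Q), |κ' w - κ w| ≤ ε) :
    ∫ z, |r' z - r z| ∂Q ≤ ε * (∫ z, |r z| ∂Q) / lam := by
  set d : Ω → ℝ := fun z => r' z - r z
  have hd : MemLp d ⊤ Q := hr'.memLp.sub hr.memLp
  have energy : lam * ∫ z, d z * d z ∂Q =
      -kernelForm Q κ' d d - kernelForm Q (fun w => κ' w - κ w) d r := by
    have expand : ∫ z, d z * d z ∂Q = ∫ z, d z * r' z ∂Q - ∫ z, d z * r z ∂Q := by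
      rw [← integral_sub ((memLp_top_mul hd hr'.memLp).integrable le_top)
        ((memLp_top_mul hd hr.memLp).integrable le_top)]
      simp only [d, mul_sub]
    rw [expand, kernelForm_kernel_sub hκ'.memLp hκ hd hr.memLp,
      kernelForm_sub_right hκ'.memLp hd hr'.memLp hr.memLp]
    linarith [hr.euler d hd, hr'.euler d hd]
  have perturbation := (neg_le_abs _).trans (abs_kernelForm_le hε hd hr.memLp)
  have hsq : lam * (∫ z, |d z| ∂Q) ^ 2 ≤ ε * ((∫ z, |d z| ∂Q) * ∫ z, |r z| ∂Q) :=
    (mul_le_mul_of_nonneg_left (sq_integral_abs_le hd) hlam.le).trans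
      (by linarith [hκ'.nonneg d hd])
  have hnonneg : 0 ≤ ε * ∫ z, |r z| ∂Q :=
    mul_nonneg hε₀ (integral_nonneg fun _ => abs_nonneg _)
  rw [le_div_iff₀ hlam]
  by_contra! hlt
  nlinarith

theorem sq_mul_sq_le (hr : IsRidgeResidual Q κ Y lam r) (hκ : IsPosSemidefKernel Q κ)
    (hY : MemLp Y ⊤ Q) :
    lam ^ 2 * (∫ z, Y z * Y z ∂Q - ∫ z, Y z * r z ∂Q) ^ 2 ≤
      kernelForm Q κ Y Y * kernelForm Q κ r r := by
  have h : kernelForm Q κ Y r = lam * (∫ z, Y z * Y z ∂Q - ∫ z, Y z * r z ∂Q) := by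
    linarith [hr.euler Y hY]
  rw [← mul_pow, ← h]
  exact hκ.sq_kernelForm_le hY hr.memLp

end IsRidgeResidual

end RidgeResidual

section FeatureMap

variable {H : Type*} [NormedAddCommGroup H] [InnerProductSpace ℝ H] {Φ : Ω → H}

theorem memLp_top_inner_prod [IsFiniteMeasure Q] (hΦ : MemLp Φ ⊤ Q) :
    MemLp (fun w : Ω × Ω => ⟪Φ w.1, Φ w.2⟫_ℝ) ⊤ (Q.prod Q) :=
  (innerSL ℝ).memLp_of_bilin ⊤ (hΦ.comp_fst Q) (hΦ.comp_snd Q)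

theorem integrable_smul_feature [IsFiniteMeasure Q] (hΦ : MemLp Φ ⊤ Q) {s : Ω → ℝ}
    (hs : MemLp s ⊤ Q) : Integrable (fun z => s z • Φ z) Q :=
  (hΦ.smul hs (r := ⊤)).integrable le_top

/-- The (uncentered) covariance operator `f ↦ ∫ ⟪Φ, f⟫ Φ dQ` of a feature map `Φ`. -/
noncomputable def featureCovariance (Q : Measure Ω) (Φ : Ω → H) : H →L[ℝ] H :=
  ∫ z, InnerProductSpace.rankOne ℝ (Φ z) (Φ z) ∂Q

theorem featureCovariance_apply [IsFiniteMeasure Q] (hΦ : MemLp Φ ⊤ Q) (f : H) :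
    featureCovariance Q Φ f = ∫ z, ⟪Φ z, f⟫_ℝ • Φ z ∂Q := by
  have hcont : Continuous fun x : H => InnerProductSpace.rankOne ℝ x x :=
    (InnerProductSpace.rankOne ℝ).continuous.clm_apply continuous_id
  have hrankOne : MemLp (fun z => InnerProductSpace.rankOne ℝ (Φ z) (Φ z)) ⊤ Q :=
    hΦ.of_bilin (fun x y => InnerProductSpace.rankOne ℝ x y) 1 hΦ
      (hcont.comp_aestronglyMeasurable hΦ.1)
      (.of_forall fun z => by
        rw [← NNReal.coe_le_coe]
        simp)
  rw [featureCovariance, ContinuousLinearMap.integral_apply (hrankOne.integrable le_top)]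
  simp only [InnerProductSpace.rankOne_apply]

variable [CompleteSpace H]

theorem integral_mul_inner [IsFiniteMeasure Q] (hΦ : MemLp Φ ⊤ Q) {s : Ω → ℝ}
    (hs : MemLp s ⊤ Q) (g : H) :
    ∫ z, s z * ⟪Φ z, g⟫_ℝ ∂Q = ⟪∫ z, s z • Φ z ∂Q, g⟫_ℝ := by
  rw [real_inner_comm, ← integral_inner (integrable_smul_feature hΦ hs)]
  simp only [inner_smul_right, real_inner_comm]

theorem kernelForm_inner [IsFiniteMeasure Q] (hΦ : MemLp Φ ⊤ Q) {r s : Ω → ℝ}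
    (hr : MemLp r ⊤ Q) (hs : MemLp s ⊤ Q) :
    kernelForm Q (fun w => ⟪Φ w.1, Φ w.2⟫_ℝ) r s = ⟪∫ z, r z • Φ z ∂Q, ∫ z, s z • Φ z ∂Q⟫_ℝ := by
  rw [kernelForm_eq_integral_integral (memLp_top_inner_prod hΦ) hr hs, ← integral_mul_inner hΦ hr]
  refine integral_congr_ae (.of_forall fun z => ?_)
  simp only [real_inner_comm (Φ _) (Φ z), integral_mul_inner hΦ hs]
  rw [real_inner_comm]

theorem isPosSemidefKernel_inner [IsFiniteMeasure Q] (hΦ : MemLp Φ ⊤ Q) :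
    IsPosSemidefKernel Q fun w => ⟪Φ w.1, Φ w.2⟫_ℝ where
  memLp := memLp_top_inner_prod hΦ
  symm := fun w => real_inner_comm _ _
  nonneg := fun r hr => by
    rw [kernelForm_inner hΦ hr hr]
    exact real_inner_self_nonneg

theorem isUnit_featureCovariance_add_smul [IsFiniteMeasure Q] (hΦ : MemLp Φ ⊤ Q) {lam : ℝ}
    (hlam : 0 < lam) : IsUnit (featureCovariance Q Φ + lam • (1 : H →L[ℝ] H)) := by
  refine ContinuousLinearMap.isUnit_of_forall_le_norm_inner_map _ (c := ⟨lam, hlam.le⟩) hlam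
    fun f => (le_abs_self _).trans' ?_
  have covariance_nonneg : 0 ≤ ⟪featureCovariance Q Φ f, f⟫_ℝ := by
    rw [featureCovariance_apply hΦ, ← integral_mul_inner hΦ (hΦ.inner_const f)]
    exact integral_nonneg fun z => mul_self_nonneg _
  simp only [add_apply, smul_apply, one_apply_eq_self, inner_add_left, real_inner_smul_left,
    real_inner_self_eq_norm_sq]
  calc ‖f‖ ^ 2 * lam ≤ ⟪featureCovariance Q Φ f, f⟫_ℝ + lam * ‖f‖ ^ 2 := by linarith

theorem exists_ridge_normal_equation [IsFiniteMeasure Q] (hΦ : MemLp Φ ⊤ Q) {Y : Ω → ℝ}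
    (hY : MemLp Y ⊤ Q) {lam : ℝ} (hlam : 0 < lam) :
    ∃ f : H, ∫ z, (Y z - ⟪Φ z, f⟫_ℝ) • Φ z ∂Q = lam • f := by
  obtain ⟨f, hf⟩ := (ContinuousLinearMap.isUnit_iff_bijective.1
    (isUnit_featureCovariance_add_smul (lam := lam) hΦ hlam)).2 (∫ z, Y z • Φ z ∂Q)
  refine ⟨f, ?_⟩
  simp only [sub_smul]
  rw [integral_sub (integrable_smul_feature hΦ hY)
    (integrable_smul_feature hΦ (hΦ.inner_const f)), ← featureCovariance_apply hΦ, ← hf]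
  simp

variable {Y : Ω → ℝ} {lam : ℝ} {f : H}

theorem isRidgeResidual_of_normal_equation [IsFiniteMeasure Q] (hΦ : MemLp Φ ⊤ Q)
    (hY : MemLp Y ⊤ Q) (hf : ∫ z, (Y z - ⟪Φ z, f⟫_ℝ) • Φ z ∂Q = lam • f) :
    IsRidgeResidual Q (fun w => ⟪Φ w.1, Φ w.2⟫_ℝ) Y lam fun z => Y z - ⟪Φ z, f⟫_ℝ where
  memLp := hY.sub (hΦ.inner_const f)
  euler := fun s hs => by
    have hr : MemLp (fun z => Y z - ⟪Φ z, f⟫_ℝ) ⊤ Q := hY.sub (hΦ.inner_const f)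
    rw [kernelForm_inner hΦ hs hr, hf]
    simp only [mul_sub, inner_smul_right]
    rw [integral_sub ((memLp_top_mul hs hY).integrable le_top)
      ((memLp_top_mul hs (hΦ.inner_const f)).integrable le_top), integral_mul_inner hΦ hs]
    ring

theorem ridgeObjective_add [IsFiniteMeasure Q] (hΦ : MemLp Φ ⊤ Q) (hY : MemLp Y ⊤ Q)
    (hf : ∫ z, (Y z - ⟪Φ z, f⟫_ℝ) • Φ z ∂Q = lam • f) (h : H) :
    1 / 2 * ∫ z, (Y z - ⟪Φ z, f + h⟫_ℝ) ^ 2 ∂Q + lam / 2 * ‖f + h‖ ^ 2 =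
      1 / 2 * ∫ z, Y z * (Y z - ⟪Φ z, f⟫_ℝ) ∂Q +
        (1 / 2 * ∫ z, ⟪Φ z, h⟫_ℝ ^ 2 ∂Q + lam / 2 * ‖h‖ ^ 2) := by
  set r : Ω → ℝ := fun z => Y z - ⟪Φ z, f⟫_ℝ
  have hr : MemLp r ⊤ Q := hY.sub (hΦ.inner_const f)
  have integral_residual_mul (g : H) : ∫ z, r z * ⟪Φ z, g⟫_ℝ ∂Q = lam * ⟪f, g⟫_ℝ := by
    rw [integral_mul_inner hΦ hr, hf, real_inner_smul_left]
  have integrable_residual_mul (g : H) : Integrable (fun z => r z * ⟪Φ z, g⟫_ℝ) Q :=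
    (memLp_top_mul hr (hΦ.inner_const g)).integrable le_top
  have hYr : Integrable (fun z => Y z * r z) Q := (memLp_top_mul hY hr).integrable le_top
  have hrr : Integrable (fun z => Y z * r z - r z * ⟪Φ z, f⟫_ℝ) Q :=
    hYr.sub (integrable_residual_mul f)
  have hcross : Integrable (fun z => 2 * (r z * ⟪Φ z, h⟫_ℝ)) Q :=
    (integrable_residual_mul h).const_mul 2
  have hlinear : Integrable
      (fun z => Y z * r z - r z * ⟪Φ z, f⟫_ℝ - 2 * (r z * ⟪Φ z, h⟫_ℝ)) Q := hrr.sub hcross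
  have hhh : Integrable (fun z => ⟪Φ z, h⟫_ℝ ^ 2) Q :=
    ((hΦ.inner_const h).mono_exponent le_top).integrable_sq
  have expand : ∫ z, (Y z - ⟪Φ z, f + h⟫_ℝ) ^ 2 ∂Q =
      ∫ z, Y z * r z ∂Q - lam * ⟪f, f⟫_ℝ - 2 * (lam * ⟪f, h⟫_ℝ) + ∫ z, ⟪Φ z, h⟫_ℝ ^ 2 ∂Q := by
    rw [← integral_residual_mul, ← integral_residual_mul, ← integral_const_mul,
      ← integral_sub hYr (integrable_residual_mul f), ← integral_sub hrr hcross,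
      ← integral_add hlinear hhh]
    refine integral_congr_ae (.of_forall fun z => ?_)
    simp only [r, inner_add_right]
    ring
  rw [expand, norm_add_sq_real, real_inner_self_eq_norm_sq]
  ring

theorem iInf_ridgeObjective [IsFiniteMeasure Q] (hΦ : MemLp Φ ⊤ Q) (hY : MemLp Y ⊤ Q)
    (hlam : 0 ≤ lam) (hf : ∫ z, (Y z - ⟪Φ z, f⟫_ℝ) • Φ z ∂Q = lam • f) :
    ⨅ g : H, (1 / 2 * ∫ z, (Y z - ⟪Φ z, g⟫_ℝ) ^ 2 ∂Q + lam / 2 * ‖g‖ ^ 2) =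
      1 / 2 * ∫ z, Y z * (Y z - ⟪Φ z, f⟫_ℝ) ∂Q := by
  refine IsLeast.csInf_eq ⟨⟨f, ?_⟩, ?_⟩
  · simpa using ridgeObjective_add hΦ hY hf 0
  · rintro _ ⟨g, rfl⟩
    dsimp only
    rw [← add_sub_cancel f g, ridgeObjective_add hΦ hY hf]
    exact le_add_of_nonneg_right (add_nonneg
      (mul_nonneg (by norm_num) (integral_nonneg fun z => sq_nonneg _)) (by positivity))

end FeatureMap

end Ridge

/-! ### The kernel space -/

section Kernel

open scoped InnerProductSpace

variable {p : ℕ}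

section PairKernel

/-- An observation `(x, y)` of the covariates and the response. -/
abbrev Sample (p : ℕ) : Type := (Fin p → ℝ) × ℝ

/-- The gap `|x_j - x'_j|^q` of two observations in coordinate `j`. -/
def coordGap (q : ℕ) (j : Fin p) (w : Sample p × Sample p) : ℝ :=
  |w.1.1 j - w.2.1 j| ^ q

/-- The weighted distance `∑ β_i |x_i - x'_i|^q`, which is `‖β^{1/q} ⊙ (x - x')‖_q^q` for
`β ≥ 0`. -/
def weightedGap (q : ℕ) (β : Fin p → ℝ) (w : Sample p × Sample p) : ℝ :=
  ∑ i, β i * coordGap q i w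

/-- The kernel obtained from the `n`-th moment of `μ`; for `n = 0` it is the kernel of
`KernelSpace μ q p` between the rescaled covariates, and the higher moments are, up to sign, its
derivatives in the weighted distance. -/
noncomputable def pairKernel (μ : Measure ℝ≥0) (n q : ℕ) (β : Fin p → ℝ)
    (w : Sample p × Sample p) : ℝ :=
  laplaceMoment μ n (weightedGap q β w)

theorem coordGap_nonneg (q : ℕ) (j : Fin p) (w : Sample p × Sample p) : 0 ≤ coordGap q j w := by
  unfold coordGap
  positivity

theorem weightedGap_nonneg (q : ℕ) {β : Fin p → ℝ} (hβ : ∀ i, 0 ≤ β i)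
    (w : Sample p × Sample p) : 0 ≤ weightedGap q β w :=
  Finset.sum_nonneg fun i _ => mul_nonneg (hβ i) (coordGap_nonneg q i w)

theorem measurable_coordGap (q : ℕ) (j : Fin p) : Measurable (coordGap q j) := by
  unfold coordGap
  fun_prop

theorem measurable_weightedGap (q : ℕ) (β : Fin p → ℝ) : Measurable (weightedGap q β) :=
  Finset.measurable_fun_sum _ fun i _ => (measurable_coordGap q i).const_mul _

theorem coordGap_swap (q : ℕ) (j : Fin p) (w : Sample p × Sample p) :
    coordGap q j w.swap = coordGap q j w := by
  simp [coordGap, abs_sub_comm]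

theorem pairKernel_swap (μ : Measure ℝ≥0) (n q : ℕ) (β : Fin p → ℝ) (w : Sample p × Sample p) :
    pairKernel μ n q β w.swap = pairKernel μ n q β w := by
  simp [pairKernel, weightedGap, coordGap_swap]

theorem pairKernel_nonneg (μ : Measure ℝ≥0) (n q : ℕ) (β : Fin p → ℝ)
    (w : Sample p × Sample p) : 0 ≤ pairKernel μ n q β w :=
  laplaceMoment_nonneg _ _ _

variable {μ : Measure ℝ≥0} [IsFiniteMeasure μ] {T : ℝ} (hT : ∀ᵐ t : ℝ≥0 ∂μ, (t : ℝ) ≤ T)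
include hT

theorem measurable_pairKernel (n q : ℕ) (β : Fin p → ℝ) : Measurable (pairKernel μ n q β) :=
  (continuous_laplaceMoment hT n).measurable.comp (measurable_weightedGap q β)

theorem pairKernel_le (n q : ℕ) {β : Fin p → ℝ} (hβ : ∀ i, 0 ≤ β i) (w : Sample p × Sample p) :
    pairKernel μ n q β w ≤ laplaceMoment μ n 0 :=
  laplaceMoment_le_at_zero hT n (weightedGap_nonneg q hβ w)

theorem memLp_top_pairKernel (n q : ℕ) {β : Fin p → ℝ} (hβ : ∀ i, 0 ≤ β i)
    (P : Measure (Sample p × Sample p)) : MemLp (pairKernel μ n q β) ⊤ P :=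
  memLp_top_of_bound (measurable_pairKernel hT n q β).aestronglyMeasurable
    (laplaceMoment μ n 0) (.of_forall fun w => by
      rw [Real.norm_of_nonneg (pairKernel_nonneg _ _ _ _ _)]
      exact pairKernel_le hT n q hβ w)

end PairKernel

section KernelSpace

variable {μ : Measure ℝ≥0} [IsFiniteMeasure μ] {q : ℕ} [hq : Fact (q = 1 ∨ q = 2)]

theorem ne_zero_of_eq_one_or_eq_two (hq : q = 1 ∨ q = 2) : q ≠ 0 := by
  rcases hq with rfl | rfl <;> norm_num

theorem abs_rescale_sub_pow {q : ℕ} (hq : q ≠ 0) {β : Fin p → ℝ} (hβ : ∀ i, 0 ≤ β i)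
    (x y : Fin p → ℝ) (i : Fin p) :
    |rescale q β x i - rescale q β y i| ^ q = β i * |x i - y i| ^ q := by
  rw [rescale, rescale, ← mul_sub, abs_mul, mul_pow,
    abs_of_nonneg (Real.rpow_nonneg (hβ i) _), one_div, Real.rpow_inv_natCast_pow (hβ i) hq]

/-- The canonical feature `k(x, ·)` of `x` in the reproducing kernel Hilbert space. -/
noncomputable def kernelFeature (μ : Measure ℝ≥0) [IsFiniteMeasure μ] (q : ℕ)
    [Fact (q = 1 ∨ q = 2)] (x : Fin p → ℝ) : KernelSpace μ q p :=
  RKHS.kerFun (KernelSpace μ q p) x 1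

theorem inner_kernelFeature (x : Fin p → ℝ) (f : KernelSpace μ q p) :
    ⟪kernelFeature μ q x, f⟫_ℝ = f x := by
  rw [kernelFeature, RKHS.kerFun_inner]
  simp

theorem kernelFeature_apply (x y : Fin p → ℝ) :
    kernelFeature μ q x y = laplaceFun μ (∑ i, |x i - y i| ^ q) := by
  rw [kernelFeature, RKHS.kerFun_apply, RKHS.OfKernel.kernel_ofKernel]
  simp [kernelMatrix, abs_sub_comm]

theorem norm_kernelFeature_sq (x : Fin p → ℝ) :
    ‖kernelFeature μ q x‖ ^ 2 = laplaceFun μ 0 := by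
  rw [← real_inner_self_eq_norm_sq, inner_kernelFeature, kernelFeature_apply]
  simp [ne_zero_of_eq_one_or_eq_two hq.out]

theorem norm_kernelFeature (x : Fin p → ℝ) : ‖kernelFeature μ q x‖ = √(laplaceFun μ 0) := by
  rw [← norm_kernelFeature_sq (q := q) x, Real.sqrt_sq (norm_nonneg _)]

theorem norm_kernelFeature_sub (x y : Fin p → ℝ) :
    ‖kernelFeature μ q x - kernelFeature μ q y‖ =
      √(2 * laplaceFun μ 0 - 2 * laplaceFun μ (∑ i, |x i - y i| ^ q)) := by
  rw [← Real.sqrt_sq (norm_nonneg (_ - _)), norm_sub_sq_real, norm_kernelFeature_sq,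
    norm_kernelFeature_sq, real_inner_comm, inner_kernelFeature, kernelFeature_apply]
  ring_nf

theorem abs_apply_le (f : KernelSpace μ q p) (x : Fin p → ℝ) :
    |f x| ≤ √(laplaceFun μ 0) * ‖f‖ := by
  rw [← inner_kernelFeature, ← norm_kernelFeature (q := q) x]
  exact abs_real_inner_le_norm _ _

theorem kernelFeature_rescale_apply {β : Fin p → ℝ} (hβ : ∀ i, 0 ≤ β i) (x y : Fin p → ℝ) :
    kernelFeature μ q (rescale q β x) (rescale q β y) =
      laplaceMoment μ 0 (∑ i, β i * |x i - y i| ^ q) := by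
  simp only [kernelFeature_apply, laplaceMoment_zero,
    abs_rescale_sub_pow (ne_zero_of_eq_one_or_eq_two hq.out) hβ]

theorem inner_kernelFeature_rescale {β : Fin p → ℝ} (hβ : ∀ i, 0 ≤ β i)
    (w : Sample p × Sample p) :
    ⟪kernelFeature μ q (rescale q β w.1.1), kernelFeature μ q (rescale q β w.2.1)⟫_ℝ =
      pairKernel μ 0 q β w := by
  rw [real_inner_comm, inner_kernelFeature, kernelFeature_rescale_apply hβ]
  rfl

theorem measurable_rescale (q : ℕ) (β : Fin p → ℝ) : Measurable (rescale q β) := by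
  unfold rescale
  fun_prop

section Continuity

variable {T : ℝ} (hT : ∀ᵐ t : ℝ≥0 ∂μ, (t : ℝ) ≤ T)
include hT

theorem continuous_kernelFeature :
    Continuous (kernelFeature μ q : (Fin p → ℝ) → KernelSpace μ q p) := by
  refine continuous_iff_continuousAt.2 fun x => tendsto_iff_norm_sub_tendsto_zero.2 ?_
  simp only [norm_kernelFeature_sub]
  have hlaplace : Continuous (laplaceFun μ) := laplaceMoment_zero μ ▸ continuous_laplaceMoment hT 0
  have hcont : Continuous fun y : Fin p → ℝ =>
      √(2 * laplaceFun μ 0 - 2 * laplaceFun μ (∑ i, |y i - x i| ^ q)) := by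
    fun_prop
  simpa [ne_zero_of_eq_one_or_eq_two hq.out] using hcont.tendsto x

theorem continuous_kernelSpace (f : KernelSpace μ q p) : Continuous f := by
  have : (f : (Fin p → ℝ) → ℝ) = fun x => ⟪kernelFeature μ q x, f⟫_ℝ :=
    funext fun x => (inner_kernelFeature x f).symm
  rw [this]
  exact (continuous_kernelFeature hT).inner continuous_const

theorem memLp_top_kernelFeature_rescale (Q : Measure (Sample p)) (β : Fin p → ℝ) :
    MemLp (fun z => kernelFeature μ q (rescale q β z.1)) ⊤ Q :=
  memLp_top_of_bound ((continuous_kernelFeature hT).stronglyMeasurable.comp_measurable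
    ((measurable_rescale q β).comp measurable_fst)).aestronglyMeasurable _
    (.of_forall fun _ => (norm_kernelFeature _).le)

theorem isPosSemidefKernel_pairKernel (Q : Measure (Sample p)) [IsFiniteMeasure Q]
    {β : Fin p → ℝ} (hβ : ∀ i, 0 ≤ β i) : IsPosSemidefKernel Q (pairKernel μ 0 q β) := by
  simpa only [inner_kernelFeature_rescale hβ] using
    isPosSemidefKernel_inner (memLp_top_kernelFeature_rescale (q := q) hT Q β)

end Continuity

/-- The residual `r(x, y) = y - f(β^{1/q} ⊙ x)` of the minimizer `f` in the kernel ridge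
regression with weights `β`, whose optimal value is `½ E[Y r]`. -/
structure IsKrrResidual (μ : Measure ℝ≥0) [IsFiniteMeasure μ] (q : ℕ) [Fact (q = 1 ∨ q = 2)]
    (Q : Measure (Sample p)) (lam : ℝ) (β : Fin p → ℝ) (r : Sample p → ℝ) : Prop
    extends IsRidgeResidual Q (pairKernel μ 0 q β) Prod.snd lam r where
  value : krrObjective μ q Q lam β = 1 / 2 * ∫ z, r z * z.2 ∂Q
  fitted : ∃ f : KernelSpace μ q p, ∀ z, r z = z.2 - f (rescale q β z.1)

theorem exists_isKrrResidual {T : ℝ} (hT : ∀ᵐ t : ℝ≥0 ∂μ, (t : ℝ) ≤ T)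
    {Q : Measure (Sample p)} [IsFiniteMeasure Q] (hY : MemLp Prod.snd ⊤ Q) {lam : ℝ}
    (hlam : 0 < lam) {β : Fin p → ℝ} (hβ : ∀ i, 0 ≤ β i) :
    ∃ r, IsKrrResidual μ q Q lam β r := by
  have hΦ := memLp_top_kernelFeature_rescale (q := q) hT Q β
  obtain ⟨f, hf⟩ := exists_ridge_normal_equation hΦ hY hlam
  have hresidual := isRidgeResidual_of_normal_equation hΦ hY hf
  have hvalue := iInf_ridgeObjective hΦ hY hlam.le hf
  simp only [inner_kernelFeature_rescale hβ] at hresidual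
  simp only [inner_kernelFeature] at hresidual hvalue
  refine ⟨fun z => z.2 - f (rescale q β z.1), hresidual, ?_, f, fun z => rfl⟩
  rw [krrObjective, hvalue]
  simp only [mul_comm (Prod.snd _)]

variable (Q : Measure (Sample p)) {lam : ℝ} (hlam : 0 ≤ lam) (β : Fin p → ℝ)
include hlam

theorem krrObjective_le (f : KernelSpace μ q p) : krrObjective μ q Q lam β ≤
    1 / 2 * ∫ z, (z.2 - f (rescale q β z.1)) ^ 2 ∂Q + lam / 2 * ‖f‖ ^ 2 := by
  refine ciInf_le ⟨0, ?_⟩ f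
  rintro _ ⟨g, rfl⟩
  exact add_nonneg (mul_nonneg (by norm_num) (integral_nonneg fun z => sq_nonneg _))
    (by positivity)

theorem krrObjective_nonneg : 0 ≤ krrObjective μ q Q lam β :=
  Real.iInf_nonneg fun f => add_nonneg
    (mul_nonneg (by norm_num) (integral_nonneg fun z => sq_nonneg _)) (by positivity)

end KernelSpace

end Kernel

/-! ### The gradient of the objective -/

section Gradient

variable {p : ℕ}

/-- A common bound for the data and for the moments of the kernel, so that the estimates below
depend on a single constant. -/
structure CommonBound (μ : Measure ℝ≥0) (q : ℕ) (Q : Measure (Sample p)) (C : ℝ) : Prop where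
  one_le : 1 ≤ C
  response_le : ∀ᵐ z ∂Q, |z.2| ≤ C
  coordGap_le : ∀ᵐ w ∂(Q.prod Q), ∀ j, coordGap q j w ≤ C
  moment_le : ∀ n ≤ 2, laplaceMoment μ n 0 ≤ C
  mass_le : ∀ᵐ t : ℝ≥0 ∂μ, (t : ℝ) ≤ C

theorem exists_commonBound {μ : Measure ℝ≥0} (hμ : KernelAssumption μ) (q : ℕ)
    {Q : Measure (Sample p)} (hQ : DistributionAssumption Q) : ∃ C, CommonBound μ q Q C := by
  obtain ⟨_, T, _, hT⟩ := hμ.ae_mem_Icc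
  obtain ⟨A, B, hAB⟩ := hQ.bounded
  refine Eventually.exists (f := atTop) ?_
  filter_upwards [eventually_ge_atTop 1, eventually_ge_atTop B, eventually_ge_atTop ((A + A) ^ q),
    eventually_ge_atTop T, (eventually_all_finite (Set.finite_le_nat 2)).2 fun n _ =>
      eventually_ge_atTop (laplaceMoment μ n 0)] with C hone hB hA hmass hmoment
  refine ⟨hone, hAB.mono fun z hz => hz.2.trans hB, ?_, hmoment,
    hT.mono fun t ht => ht.2.trans hmass⟩
  filter_upwards [Measure.quasiMeasurePreserving_fst.ae hAB,
    Measure.quasiMeasurePreserving_snd.ae hAB] with w hfst hsnd j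
  exact (pow_le_pow_left₀ (abs_nonneg _)
    ((abs_sub _ _).trans (add_le_add (hfst.1 j) (hsnd.1 j))) q).trans hA

/-- Up to sign, the derivative of the kernel `pairKernel μ 0 q β` in `β_j`. -/
noncomputable def gradKernel (μ : Measure ℝ≥0) (q : ℕ) (β : Fin p → ℝ) (j : Fin p)
    (w : Sample p × Sample p) : ℝ :=
  pairKernel μ 1 q β w * coordGap q j w

theorem abs_weightedGap_sub_le {q : ℕ} {C : ℝ} {w : Sample p × Sample p}
    (hw : ∀ j, coordGap q j w ≤ C) (β γ : Fin p → ℝ) :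
    |weightedGap q γ w - weightedGap q β w| ≤ C * ∑ i, |γ i - β i| := by
  rw [weightedGap, weightedGap, ← Finset.sum_sub_distrib, Finset.mul_sum]
  refine (Finset.abs_sum_le_sum_abs _ _).trans (Finset.sum_le_sum fun i _ => ?_)
  rw [← sub_mul, abs_mul, abs_of_nonneg (coordGap_nonneg q i w), mul_comm]
  exact mul_le_mul_of_nonneg_right (hw i) (abs_nonneg _)

namespace CommonBound

variable {μ : Measure ℝ≥0} {q : ℕ} {Q : Measure (Sample p)} {C lam : ℝ}

theorem pos (hC : CommonBound μ q Q C) : 0 < C :=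
  one_pos.trans_le hC.one_le

theorem pow_five_le (hC : CommonBound μ q Q C) (hlam : 0 < lam) (hlam1 : lam ≤ 1) :
    C ^ 5 ≤ C ^ 6 / lam := by
  have := hC.pos
  rw [le_div_iff₀ hlam]
  calc C ^ 5 * lam ≤ C ^ 5 * C := by gcongr; exact hlam1.trans hC.one_le
    _ = C ^ 6 := by ring

theorem memLp_response (hC : CommonBound μ q Q C) : MemLp (Prod.snd : Sample p → ℝ) ⊤ Q :=
  memLp_top_of_bound measurable_snd.aestronglyMeasurable C hC.response_le

theorem memLp_coordGap (hC : CommonBound μ q Q C) (j : Fin p) :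
    MemLp (coordGap q j) ⊤ (Q.prod Q) :=
  memLp_top_of_bound (measurable_coordGap q j).aestronglyMeasurable C
    (hC.coordGap_le.mono fun w hw => by
      rw [Real.norm_of_nonneg (coordGap_nonneg _ _ _)]
      exact hw j)

theorem memLp_weightedGap (hC : CommonBound μ q Q C) (η : Fin p → ℝ) :
    MemLp (weightedGap q η) ⊤ (Q.prod Q) :=
  memLp_finsetSum _ fun i _ => (hC.memLp_coordGap i).const_mul (η i)

variable [IsFiniteMeasure μ] {β γ : Fin p → ℝ}

theorem memLp_gradKernel (hC : CommonBound μ q Q C) (hβ : ∀ i, 0 ≤ β i) (j : Fin p) :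
    MemLp (gradKernel μ q β j) ⊤ (Q.prod Q) :=
  memLp_top_mul (memLp_top_pairKernel hC.mass_le 1 q hβ _) (hC.memLp_coordGap j)

theorem abs_pairKernel_sub_le (hC : CommonBound μ q Q C) {n : ℕ} (hn : n ≤ 1)
    (hβ : ∀ i, 0 ≤ β i) (hγ : ∀ i, 0 ≤ γ i) :
    ∀ᵐ w ∂(Q.prod Q), |pairKernel μ n q γ w - pairKernel μ n q β w| ≤
      C ^ 2 * ∑ i, |γ i - β i| := by
  filter_upwards [hC.coordGap_le] with w hw
  refine (abs_laplaceMoment_sub_le hC.mass_le n (weightedGap_nonneg q hβ w)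
    (weightedGap_nonneg q hγ w)).trans ?_
  rw [sq, mul_assoc]
  exact mul_le_mul (hC.moment_le _ (by lia)) (abs_weightedGap_sub_le hw β γ) (abs_nonneg _)
    hC.pos.le

theorem abs_pairKernel_taylor_le (hC : CommonBound μ q Q C) (hβ : ∀ i, 0 ≤ β i)
    (hγ : ∀ i, 0 ≤ γ i) :
    ∀ᵐ w ∂(Q.prod Q), |pairKernel μ 0 q γ w - pairKernel μ 0 q β w +
      pairKernel μ 1 q β w * weightedGap q (γ - β) w| ≤ C ^ 3 * (∑ i, |γ i - β i|) ^ 2 := by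
  filter_upwards [hC.coordGap_le] with w hw
  have weightedGap_sub : weightedGap q (γ - β) w = weightedGap q γ w - weightedGap q β w := by
    simp [weightedGap, sub_mul]
  rw [weightedGap_sub]
  calc _ ≤ laplaceMoment μ 2 0 * (weightedGap q γ w - weightedGap q β w) ^ 2 :=
        abs_laplaceMoment_sub_add_le hC.mass_le 0 (weightedGap_nonneg q hβ w)
          (weightedGap_nonneg q hγ w)
    _ ≤ C * (C * ∑ i, |γ i - β i|) ^ 2 := by
        rw [← sq_abs (_ - _)]
        exact mul_le_mul (hC.moment_le 2 le_rfl)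
          (pow_le_pow_left₀ (abs_nonneg _) (abs_weightedGap_sub_le hw β γ) 2) (sq_nonneg _)
          hC.pos.le
    _ = _ := by ring

theorem abs_gradKernel_le (hC : CommonBound μ q Q C) (hβ : ∀ i, 0 ≤ β i) (j : Fin p) :
    ∀ᵐ w ∂(Q.prod Q), |gradKernel μ q β j w| ≤ C ^ 2 := by
  filter_upwards [hC.coordGap_le] with w hw
  rw [gradKernel, abs_mul, abs_of_nonneg (coordGap_nonneg _ _ _),
    abs_of_nonneg (pairKernel_nonneg _ _ _ _ _), sq]
  exact mul_le_mul ((pairKernel_le hC.mass_le 1 q hβ w).trans (hC.moment_le 1 one_le_two))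
    (hw j) (coordGap_nonneg _ _ _) hC.pos.le

theorem abs_gradKernel_sub_le (hC : CommonBound μ q Q C) (hβ : ∀ i, 0 ≤ β i)
    (hγ : ∀ i, 0 ≤ γ i) (j : Fin p) :
    ∀ᵐ w ∂(Q.prod Q), |gradKernel μ q γ j w - gradKernel μ q β j w| ≤
      C ^ 3 * ∑ i, |γ i - β i| := by
  filter_upwards [hC.coordGap_le, hC.abs_pairKernel_sub_le le_rfl hβ hγ] with w hw hsub
  rw [gradKernel, gradKernel, ← sub_mul, abs_mul, abs_of_nonneg (coordGap_nonneg _ _ _)]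
  calc _ ≤ (C ^ 2 * ∑ i, |γ i - β i|) * C :=
        mul_le_mul hsub (hw j) (coordGap_nonneg _ _ _) (by positivity)
    _ = _ := by ring

end CommonBound

/-- The partial derivative `∂_{β_j} F(β) = (1 / (2 λ)) ∫∫ r(z) r(z') κ_j(z, z') Q(dz) Q(dz')` of the
objective in terms of the residual `r` at `β` and of `κ_j = gradKernel μ q β j`. -/
noncomputable def krrGradient (μ : Measure ℝ≥0) (q : ℕ) (Q : Measure (Sample p))
    (lam : ℝ) (β : Fin p → ℝ) (r : Sample p → ℝ) (j : Fin p) : ℝ :=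
  1 / (2 * lam) * kernelForm Q (gradKernel μ q β j) r r

namespace IsKrrResidual

variable {μ : Measure ℝ≥0} [IsFiniteMeasure μ] {q : ℕ} [Fact (q = 1 ∨ q = 2)]
  {Q : Measure (Sample p)} [IsProbabilityMeasure Q] {C lam : ℝ} {β γ : Fin p → ℝ}
  {r s : Sample p → ℝ}

theorem integral_abs_le (hr : IsKrrResidual μ q Q lam β r) (hC : CommonBound μ q Q C)
    (hlam : 0 < lam) (hβ : ∀ i, 0 ≤ β i) : ∫ z, |r z| ∂Q ≤ C :=
  hr.toIsRidgeResidual.integral_abs_le (isPosSemidefKernel_pairKernel hC.mass_le Q hβ) hlam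
    hC.pos.le hC.response_le

theorem integral_abs_sub_le (hr : IsKrrResidual μ q Q lam β r) (hs : IsKrrResidual μ q Q lam γ s)
    (hC : CommonBound μ q Q C) (hlam : 0 < lam) (hβ : ∀ i, 0 ≤ β i) (hγ : ∀ i, 0 ≤ γ i) :
    ∫ z, |s z - r z| ∂Q ≤ C ^ 3 * (∑ i, |γ i - β i|) / lam := by
  have hr_le := hr.integral_abs_le hC hlam hβ
  calc _ ≤ C ^ 2 * (∑ i, |γ i - β i|) * (∫ z, |r z| ∂Q) / lam :=
        hr.toIsRidgeResidual.integral_abs_sub_le hs.toIsRidgeResidual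
          (memLp_top_pairKernel hC.mass_le 0 q hβ _)
          (isPosSemidefKernel_pairKernel hC.mass_le Q hγ) hlam (by positivity)
          (hC.abs_pairKernel_sub_le zero_le_one hβ hγ)
    _ ≤ C ^ 2 * (∑ i, |γ i - β i|) * C / lam := by gcongr
    _ = _ := by ring

theorem krrObjective_sub (hr : IsKrrResidual μ q Q lam β r) (hs : IsKrrResidual μ q Q lam γ s)
    (hC : CommonBound μ q Q C) (hlam : 0 < lam) (hβ : ∀ i, 0 ≤ β i) (hγ : ∀ i, 0 ≤ γ i) :
    krrObjective μ q Q lam γ - krrObjective μ q Q lam β = -(1 / (2 * lam)) *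
      kernelForm Q (fun w => pairKernel μ 0 q γ w - pairKernel μ 0 q β w) r s := by
  have h := hr.toIsRidgeResidual.integral_mul_sub_eq hs.toIsRidgeResidual
    (pairKernel_swap μ 0 q β)
  rw [kernelForm_kernel_sub (memLp_top_pairKernel hC.mass_le 0 q hγ _)
    (memLp_top_pairKernel hC.mass_le 0 q hβ _) hr.memLp hs.memLp, hr.value, hs.value]
  field_simp
  linarith

theorem abs_krrObjective_sub_le (hr : IsKrrResidual μ q Q lam β r)
    (hs : IsKrrResidual μ q Q lam γ s) (hC : CommonBound μ q Q C) (hlam : 0 < lam)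
    (hβ : ∀ i, 0 ≤ β i) (hγ : ∀ i, 0 ≤ γ i) :
    |krrObjective μ q Q lam γ - krrObjective μ q Q lam β| ≤ C ^ 4 / lam * ∑ i, |γ i - β i| := by
  have hC₀ := hC.pos
  rw [hr.krrObjective_sub hs hC hlam hβ hγ, abs_mul, abs_neg, abs_of_pos (by positivity)]
  calc _ ≤ 1 / (2 * lam) * (C ^ 2 * (∑ i, |γ i - β i|) * (C * C)) := by
        refine mul_le_mul_of_nonneg_left ((abs_kernelForm_le
          (hC.abs_pairKernel_sub_le zero_le_one hβ hγ) hr.memLp hs.memLp).trans ?_) (by positivity)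
        gcongr
        exacts [hr.integral_abs_le hC hlam hβ, hs.integral_abs_le hC hlam hγ]
    _ = C ^ 4 / lam * (∑ i, |γ i - β i|) / 2 := by field_simp
    _ ≤ _ := half_le_self (by positivity)

theorem sum_mul_krrGradient (hr : IsKrrResidual μ q Q lam β r) (hC : CommonBound μ q Q C)
    (hβ : ∀ i, 0 ≤ β i) (η : Fin p → ℝ) :
    ∑ j, η j * krrGradient μ q Q lam β r j = 1 / (2 * lam) *
      kernelForm Q (fun w => pairKernel μ 1 q β w * weightedGap q η w) r r := by
  have expand : kernelForm Q (fun w => pairKernel μ 1 q β w * weightedGap q η w) r r =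
      ∑ j, η j * kernelForm Q (gradKernel μ q β j) r r := by
    simp only [kernelForm, ← integral_const_mul]
    rw [← integral_finsetSum _ fun j _ => (integrable_kernelForm (hC.memLp_gradKernel hβ j)
      hr.memLp hr.memLp).const_mul _]
    refine integral_congr_ae (.of_forall fun w => ?_)
    simp only [gradKernel, weightedGap, Finset.mul_sum]
    exact Finset.sum_congr rfl fun j _ => by ring
  rw [expand, Finset.mul_sum]
  exact Finset.sum_congr rfl fun j _ => mul_left_comm _ _ _

theorem abs_kernelForm_taylor_le (hr : IsKrrResidual μ q Q lam β r)
    (hs : IsKrrResidual μ q Q lam γ s) (hC : CommonBound μ q Q C) (hlam : 0 < lam)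
    (hlam1 : lam ≤ 1) (hβ : ∀ i, 0 ≤ β i) (hγ : ∀ i, 0 ≤ γ i) :
    |kernelForm Q (fun w => pairKernel μ 0 q γ w - pairKernel μ 0 q β w) r s +
        kernelForm Q (fun w => pairKernel μ 1 q β w * weightedGap q (γ - β) w) r r| ≤
      2 * (C ^ 6 / lam) * (∑ i, |γ i - β i|) ^ 2 := by
  have hC₀ := hC.pos
  have hr_le := hr.integral_abs_le hC hlam hβ
  have hsub_le := hr.integral_abs_sub_le hs hC hlam hβ hγ
  set σ := ∑ i, |γ i - β i|
  have perturbation := abs_kernelForm_sub_le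
    (κ := fun w => -(pairKernel μ 1 q β w * weightedGap q (γ - β) w))
    (κ' := fun w => pairKernel μ 0 q γ w - pairKernel μ 0 q β w)
    (memLp_top_mul (memLp_top_pairKernel hC.mass_le 1 q hβ _) (hC.memLp_weightedGap _)).neg
    ((memLp_top_pairKernel hC.mass_le 0 q hγ _).sub (memLp_top_pairKernel hC.mass_le 0 q hβ _))
    (hC.abs_pairKernel_sub_le zero_le_one hβ hγ)
    (by simpa only [sub_neg_eq_add] using hC.abs_pairKernel_taylor_le hβ hγ)
    hr.memLp hr.memLp hr.memLp hs.memLp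
  have kernelForm_neg : kernelForm Q
      (fun w => -(pairKernel μ 1 q β w * weightedGap q (γ - β) w)) r r =
      -kernelForm Q (fun w => pairKernel μ 1 q β w * weightedGap q (γ - β) w) r r := by
    simp only [kernelForm, mul_neg, integral_neg]
  rw [kernelForm_neg, sub_neg_eq_add] at perturbation
  calc _ ≤ C ^ 2 * σ * ((∫ z, |r z| ∂Q) * ∫ z, |s z - r z| ∂Q) +
        C ^ 3 * σ ^ 2 * ((∫ z, |r z| ∂Q) * ∫ z, |r z| ∂Q) := by simpa using perturbation
    _ ≤ C ^ 2 * σ * (C * (C ^ 3 * σ / lam)) + C ^ 3 * σ ^ 2 * (C * C) := by gcongr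
    _ = (C ^ 6 / lam + C ^ 5) * σ ^ 2 := by ring
    _ ≤ (C ^ 6 / lam + C ^ 6 / lam) * σ ^ 2 := by
        gcongr
        exact hC.pow_five_le hlam hlam1
    _ = _ := by ring

theorem abs_krrObjective_taylor_le (hr : IsKrrResidual μ q Q lam β r)
    (hs : IsKrrResidual μ q Q lam γ s) (hC : CommonBound μ q Q C) (hlam : 0 < lam)
    (hlam1 : lam ≤ 1) (hβ : ∀ i, 0 ≤ β i) (hγ : ∀ i, 0 ≤ γ i) :
    |krrObjective μ q Q lam γ - krrObjective μ q Q lam β -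
        ∑ j, (γ j - β j) * krrGradient μ q Q lam β r j| ≤
      C ^ 6 / lam ^ 2 * (∑ i, |γ i - β i|) ^ 2 := by
  have hgradient := hr.sum_mul_krrGradient hC hβ (γ - β)
  simp only [Pi.sub_apply] at hgradient
  rw [hgradient, hr.krrObjective_sub hs hC hlam hβ hγ, neg_mul, ← neg_add', abs_neg, ← mul_add,
    abs_mul, abs_of_pos (by positivity)]
  calc _ ≤ 1 / (2 * lam) * (2 * (C ^ 6 / lam) * (∑ i, |γ i - β i|) ^ 2) := by
        gcongr
        exact hr.abs_kernelForm_taylor_le hs hC hlam hlam1 hβ hγ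
    _ = _ := by field_simp

theorem abs_krrGradient_sub_le (hr : IsKrrResidual μ q Q lam β r)
    (hs : IsKrrResidual μ q Q lam γ s) (hC : CommonBound μ q Q C) (hlam : 0 < lam)
    (hlam1 : lam ≤ 1) (hβ : ∀ i, 0 ≤ β i) (hγ : ∀ i, 0 ≤ γ i) (j : Fin p) :
    |krrGradient μ q Q lam γ s j - krrGradient μ q Q lam β r j| ≤
      2 * C ^ 6 / lam ^ 2 * ∑ i, |γ i - β i| := by
  have hC₀ := hC.pos
  set σ := ∑ i, |γ i - β i|
  have hr_le := hr.integral_abs_le hC hlam hβ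
  have hs_le := hs.integral_abs_le hC hlam hγ
  have hsub_le := hr.integral_abs_sub_le hs hC hlam hβ hγ
  have form_bound : |kernelForm Q (gradKernel μ q γ j) s s -
      kernelForm Q (gradKernel μ q β j) r r| ≤ 4 * (C ^ 6 / lam) * σ :=
    calc _ ≤ C ^ 2 * ((C ^ 3 * σ / lam) * C) + C ^ 2 * (C * (C ^ 3 * σ / lam)) +
          C ^ 3 * σ * (C * C) := by
          refine (abs_kernelForm_sub_le (hC.memLp_gradKernel hβ j) (hC.memLp_gradKernel hγ j)
            (hC.abs_gradKernel_le hγ j) (hC.abs_gradKernel_sub_le hβ hγ j) hr.memLp hs.memLp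
            hr.memLp hs.memLp).trans ?_
          gcongr
      _ = (2 * (C ^ 6 / lam) + C ^ 5) * σ := by ring
      _ ≤ (2 * (C ^ 6 / lam) + 2 * (C ^ 6 / lam)) * σ := by
          have := hC.pow_five_le hlam hlam1
          gcongr
          linarith [show 0 ≤ C ^ 6 / lam by positivity]
      _ = _ := by ring
  rw [krrGradient, krrGradient, ← mul_sub, abs_mul, abs_of_pos (by positivity)]
  calc _ ≤ 1 / (2 * lam) * (4 * (C ^ 6 / lam) * σ) := by gcongr
    _ = _ := by field_simp; ring

end IsKrrResidual

end Gradient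

/-! ### Bounds for the residual energy -/

section Energy

variable {p : ℕ} {μ : Measure ℝ≥0} [IsFiniteMeasure μ] {q : ℕ} [Fact (q = 1 ∨ q = 2)]
  {Q : Measure (Sample p)} {C lam : ℝ} {β : Fin p → ℝ} {r : Sample p → ℝ}

theorem krrObjective_zero [IsFiniteMeasure Q] (hC : CommonBound μ q Q C) (hlam : 0 < lam)
    (hcent : ∫ z, z.2 ∂Q = 0) : krrObjective μ q Q lam 0 = 1 / 2 * ∫ z, z.2 * z.2 ∂Q := by
  obtain ⟨r, hr⟩ := exists_isKrrResidual (q := q) (β := 0) hC.mass_le hC.memLp_response hlam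
    fun _ => le_rfl
  have form_eq_zero : kernelForm Q (pairKernel μ 0 q 0) Prod.snd r = 0 := by
    have kernel_const : ∀ w : Sample p × Sample p, pairKernel μ 0 q 0 w = laplaceMoment μ 0 0 :=
      fun w => by simp [pairKernel, weightedGap]
    simp only [kernelForm, kernel_const]
    rw [integral_mul_const, integral_prod_mul (L := ℝ) Prod.snd r, hcent, zero_mul, zero_mul]
  have h := hr.euler _ hC.memLp_response
  rw [form_eq_zero, add_zero] at h
  rw [hr.value, ← mul_left_cancel₀ hlam.ne' h]
  simp only [mul_comm (r _)]

theorem IsKrrResidual.le_kernelForm_self [IsProbabilityMeasure Q]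
    (hr : IsKrrResidual μ q Q lam β r) (hC : CommonBound μ q Q C) (hlam : 0 < lam)
    (hβ : ∀ i, 0 ≤ β i) (hcent : ∫ z, z.2 ∂Q = 0) {c : ℝ} (hc : 0 ≤ c)
    (hgain : c ≤ krrObjective μ q Q lam 0 - krrObjective μ q Q lam β) :
    4 * lam ^ 2 * c ^ 2 / C ^ 3 ≤ kernelForm Q (pairKernel μ 0 q β) r r := by
  have hC₀ := hC.pos
  have hpsd := isPosSemidefKernel_pairKernel (q := q) hC.mass_le Q hβ
  have form_response_le : kernelForm Q (pairKernel μ 0 q β) Prod.snd Prod.snd ≤ C ^ 3 := by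
    have hresponse : ∫ z, |z.2| ∂Q ≤ C :=
      (integral_mono_ae (hC.memLp_response.abs.integrable le_top)
        (integrable_const C) hC.response_le).trans_eq (by simp)
    refine (le_abs_self _).trans ((abs_kernelForm_le (C := C) (.of_forall fun w => ?_)
      hC.memLp_response hC.memLp_response).trans ?_)
    · rw [abs_of_nonneg (pairKernel_nonneg _ _ _ _ _)]
      exact (pairKernel_le hC.mass_le 0 q hβ w).trans (hC.moment_le 0 zero_le_two)
    · calc _ ≤ C * (C * C) := by gcongr
        _ = _ := by ring
  have hgain' : 2 * c ≤ ∫ z, z.2 * z.2 ∂Q - ∫ z, z.2 * r z ∂Q := by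
    rw [krrObjective_zero hC hlam hcent, hr.value] at hgain
    simp only [mul_comm (r _)] at hgain
    linarith
  rw [div_le_iff₀' (by positivity)]
  calc 4 * lam ^ 2 * c ^ 2 = lam ^ 2 * (2 * c) ^ 2 := by ring
    _ ≤ lam ^ 2 * (∫ z, z.2 * z.2 ∂Q - ∫ z, z.2 * r z ∂Q) ^ 2 := by gcongr
    _ ≤ _ := hr.toIsRidgeResidual.sq_mul_sq_le hpsd hC.memLp_response
    _ ≤ _ := mul_le_mul_of_nonneg_right form_response_le (hpsd.nonneg r hr.memLp)

omit [Fact (q = 1 ∨ q = 2)] in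
theorem laplaceMoment_withDensity_sub {T m : ℝ} (hT : ∀ᵐ t : ℝ≥0 ∂μ, (t : ℝ) ≤ T)
    (hm : ∀ᵐ t : ℝ≥0 ∂μ, m ≤ (t : ℝ)) (z : ℝ) :
    laplaceMoment (μ.withDensity fun t => ENNReal.ofReal ((t : ℝ) - m)) 0 z =
      laplaceMoment μ 1 z - m * laplaceMoment μ 0 z := by
  rw [laplaceMoment, integral_withDensity_eq_integral_toReal_smul (by fun_prop)
    (.of_forall fun _ => ENNReal.ofReal_lt_top), laplaceMoment, laplaceMoment,
    ← integral_const_mul, ← integral_sub (integrable_laplaceMoment hT 1 z)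
      ((integrable_laplaceMoment hT 0 z).const_mul m)]
  refine integral_congr_ae ?_
  filter_upwards [hm] with t ht
  rw [ENNReal.toReal_ofReal (by linarith), smul_eq_mul]
  ring

/-- As `μ` lives on `[m, ∞)`, the function `-h' - m h` is again the Laplace transform of a positive
measure, so its kernel is positive semidefinite. -/
theorem mul_kernelForm_le_kernelForm_one [IsFiniteMeasure Q] {T m : ℝ}
    (hT : ∀ᵐ t : ℝ≥0 ∂μ, (t : ℝ) ≤ T) (hm : ∀ᵐ t : ℝ≥0 ∂μ, m ≤ (t : ℝ)) (hβ : ∀ i, 0 ≤ β i)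
    (hr : MemLp r ⊤ Q) :
    m * kernelForm Q (pairKernel μ 0 q β) r r ≤ kernelForm Q (pairKernel μ 1 q β) r r := by
  set ν : Measure ℝ≥0 := μ.withDensity fun t => ENNReal.ofReal ((t : ℝ) - m)
  have hcoe : Integrable (fun t : ℝ≥0 => (t : ℝ)) μ := by
    simpa using integrable_laplaceMoment hT 1 0
  have : IsFiniteMeasure ν :=
    isFiniteMeasure_withDensity_ofReal (hcoe.sub (integrable_const m)).2
  have hν : ∀ᵐ t : ℝ≥0 ∂ν, (t : ℝ) ≤ T := (withDensity_absolutelyContinuous _ _).ae_le hT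
  have kernel_eq : pairKernel ν 0 q β =
      fun w => pairKernel μ 1 q β w - m * pairKernel μ 0 q β w :=
    funext fun w => laplaceMoment_withDensity_sub hT hm _
  have hnonneg := (isPosSemidefKernel_pairKernel (q := q) hν Q hβ).nonneg r hr
  rw [kernel_eq, kernelForm_kernel_sub (memLp_top_pairKernel hT 1 q hβ _)
    ((memLp_top_pairKernel hT 0 q hβ _).const_mul m) hr hr] at hnonneg
  have form_const_mul : kernelForm Q (fun w => m * pairKernel μ 0 q β w) r r =
      m * kernelForm Q (pairKernel μ 0 q β) r r := by
    simp only [kernelForm, ← integral_const_mul, mul_left_comm]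
  linarith

end Energy

/-! ### Independence of the noise coordinates -/

section Decoupling

variable {Ω E F : Type*} {mU m mΩ : MeasurableSpace Ω} [MeasurableSpace E] [MeasurableSpace F]
  {Q : Measure Ω} {U : Ω → E} {V : Ω → F} {r s Y : Ω → ℝ}

/-- Bounded functions of `V` decouple from `r` in the presence of functions of `U`:
`E[r a(U) b(V)] = E[r a(U)] E[b(V)]`. -/
def Decouples (Q : Measure Ω) (U : Ω → E) (V : Ω → F) (r : Ω → ℝ) : Prop :=
  ∀ (a : E → ℝ) (b : F → ℝ), Measurable a → Measurable b → MemLp (fun z => a (U z)) ⊤ Q →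
    MemLp (fun z => b (V z)) ⊤ Q →
    ∫ z, r z * (a (U z) * b (V z)) ∂Q = (∫ z, r z * a (U z) ∂Q) * ∫ z, b (V z) ∂Q

theorem integral_mul_condExp [IsFiniteMeasure Q] (hm : m ≤ mΩ)
    {f : Ω → ℝ} (hfm : StronglyMeasurable[m] f) (hf : MemLp f ⊤ Q) (hY : MemLp Y ⊤ Q) :
    ∫ z, f z * (Q[Y | m]) z ∂Q = ∫ z, f z * Y z ∂Q := by
  rw [← integral_condExp hm (f := fun z => f z * Y z)]
  exact integral_congr_ae (condExp_mul_of_stronglyMeasurable_left hfm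
    ((memLp_top_mul hf hY).integrable le_top) (hY.integrable le_top)).symm

theorem decouples_of_condExp_eq [IsFiniteMeasure Q] (hmU : mU ≤ m) (hm : m ≤ mΩ)
    (hU : Measurable[mU] U) (hV : Measurable[m] V) (hY : MemLp Y ⊤ Q)
    (hcond : Q[Y | m] =ᵐ[Q] Q[Y | mU])
    (hind : Indep mU (MeasurableSpace.comap V inferInstance) Q) : Decouples Q U V Y := by
  intro a b ha hb ha' hb'
  have haU : StronglyMeasurable[mU] fun z => a (U z) := (ha.comp hU).stronglyMeasurable
  have hprod : StronglyMeasurable[mU] fun z => a (U z) * (Q[Y | mU]) z :=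
    haU.mul stronglyMeasurable_condExp
  have hbV : StronglyMeasurable[m] fun z => b (V z) := (hb.comp hV).stronglyMeasurable
  have hindep : IndepFun (fun z => a (U z) * (Q[Y | mU]) z) (fun z => b (V z)) Q :=
    (IndepFun_iff_Indep _ _ _).2 (indep_of_indep_of_le_left (indep_of_indep_of_le_right hind
      (hb.comp (comap_measurable V)).comap_le) hprod.measurable.comap_le)
  calc ∫ z, Y z * (a (U z) * b (V z)) ∂Q
      = ∫ z, (a (U z) * b (V z)) * (Q[Y | m]) z ∂Q := by
        simp only [mul_comm (Y _)]
        exact (integral_mul_condExp hm ((haU.mono hmU).mul hbV) (memLp_top_mul ha' hb') hY).symm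
    _ = ∫ z, a (U z) * (Q[Y | mU]) z * b (V z) ∂Q := by
        refine integral_congr_ae ?_
        filter_upwards [hcond] with z hz
        rw [hz, mul_right_comm]
    _ = (∫ z, a (U z) * (Q[Y | mU]) z ∂Q) * ∫ z, b (V z) ∂Q :=
        hindep.integral_fun_mul_eq_mul_integral
          (hprod.mono (hmU.trans hm)).aestronglyMeasurable hb'.1
    _ = (∫ z, Y z * a (U z) ∂Q) * ∫ z, b (V z) ∂Q := by
        rw [integral_mul_condExp (hmU.trans hm) haU ha' hY]
        simp only [mul_comm (Y _)]

theorem decouples_comp {g : E → ℝ} (hg : Measurable g) (hg' : MemLp (fun z => g (U z)) ⊤ Q)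
    (hind : IndepFun U V Q) : Decouples Q U V fun z => g (U z) := by
  intro a b ha hb ha' hb'
  simp only [← mul_assoc]
  exact (hind.comp (hg.mul ha) hb).integral_fun_mul_eq_mul_integral
    (memLp_top_mul hg' ha').1 hb'.1

namespace Decouples

theorem sub [IsFiniteMeasure Q] (hr : Decouples Q U V r) (hs : Decouples Q U V s)
    (hr' : MemLp r ⊤ Q) (hs' : MemLp s ⊤ Q) : Decouples Q U V fun z => r z - s z := by
  intro a b ha hb ha' hb'
  have integrable_mul {f g : Ω → ℝ} (hf : MemLp f ⊤ Q) (hg : MemLp g ⊤ Q) :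
      Integrable (fun z => f z * g z) Q := (memLp_top_mul hf hg).integrable le_top
  have hab := memLp_top_mul ha' hb'
  simp only [sub_mul]
  rw [integral_sub (integrable_mul hr' hab) (integrable_mul hs' hab),
    integral_sub (integrable_mul hr' ha') (integrable_mul hs' ha'), sub_mul,
    hr a b ha hb ha' hb', hs a b ha hb ha' hb']

end Decouples

theorem measurable_integral_mul_kernel [SFinite Q] {K : E × E → ℝ} (hK : Measurable K)
    (hU : Measurable U) (hr : AEStronglyMeasurable r Q) :
    Measurable fun u => ∫ z, r z * K (u, U z) ∂Q := by
  obtain ⟨r', hr'm, hr'⟩ := hr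
  have hcongr : (fun u => ∫ z, r z * K (u, U z) ∂Q) = fun u => ∫ z, r' z * K (u, U z) ∂Q :=
    funext fun u => integral_congr_ae (hr'.mono fun z hz => by simp only [hz])
  rw [hcongr]
  refine (StronglyMeasurable.integral_prod_right' (ν := Q)
    (f := fun w : E × Ω => r' w.2 * K (w.1, U w.2)) ?_).measurable
  exact ((hr'm.measurable.comp measurable_snd).mul
    (hK.comp (by fun_prop))).stronglyMeasurable

theorem memLp_integral_mul_kernel [IsFiniteMeasure Q] {K : E × E → ℝ} (hK : Measurable K)
    (hU : Measurable U) {B : ℝ} (hB : ∀ᵐ w ∂(Q.prod Q), |K (U w.1, U w.2)| ≤ B)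
    (hr : MemLp r ⊤ Q) : MemLp (fun z => ∫ z', r z' * K (U z, U z') ∂Q) ⊤ Q := by
  refine memLp_top_of_bound
    ((measurable_integral_mul_kernel hK hU hr.1).comp hU).aestronglyMeasurable
    ((∫ z, |r z| ∂Q) * B) ?_
  filter_upwards [Measure.ae_ae_of_ae_prod hB] with z hz
  rw [← integral_mul_const]
  refine norm_integral_le_of_norm_le ((hr.abs.integrable le_top).mul_const B) ?_
  filter_upwards [hz] with z' hz'
  rw [norm_mul]
  exact mul_le_mul_of_nonneg_left hz' (abs_nonneg _)

theorem memLp_top_kernel_comp {K : E × E → ℝ} (hK : Measurable K) (hU : Measurable U)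
    {B : ℝ} (hB : ∀ᵐ w ∂(Q.prod Q), |K (U w.1, U w.2)| ≤ B) :
    MemLp (fun w : Ω × Ω => K (U w.1, U w.2)) ⊤ (Q.prod Q) :=
  memLp_top_of_bound (hK.comp (by fun_prop)).aestronglyMeasurable B hB

theorem Decouples.kernelForm_mul [IsFiniteMeasure Q] (hr : Decouples Q U V r) (hr' : MemLp r ⊤ Q)
    (hU : Measurable U) (hV : Measurable V) {K : E × E → ℝ} {L : F × F → ℝ} (hK : Measurable K)
    (hL : Measurable L) {A B : ℝ} (hA : ∀ᵐ w ∂(Q.prod Q), |K (U w.1, U w.2)| ≤ A)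
    (hB : ∀ᵐ w ∂(Q.prod Q), |L (V w.1, V w.2)| ≤ B) :
    kernelForm Q (fun w => K (U w.1, U w.2) * L (V w.1, V w.2)) r r =
      kernelForm Q (fun w => K (U w.1, U w.2)) r r * ∫ w, L (V w.1, V w.2) ∂(Q.prod Q) := by
  have hKmem := memLp_top_kernel_comp hK hU hA
  have hLmem := memLp_top_kernel_comp hL hV hB
  have hone : MemLp (fun _ : Ω => (1 : ℝ)) ⊤ Q := memLp_const 1
  have hLmeas := measurable_integral_mul_kernel (Q := Q) hL hV hone.1
  have hLint := memLp_integral_mul_kernel hL hV hB hone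
  simp only [one_mul] at hLmeas hLint
  rw [kernelForm_eq_integral_integral (memLp_top_mul hKmem hLmem) hr' hr',
    kernelForm_eq_integral_integral hKmem hr' hr', integral_prod _ (hLmem.integrable le_top),
    ← hr _ _ (measurable_integral_mul_kernel hK hU hr'.1) hLmeas
      (memLp_integral_mul_kernel hK hU hA hr') hLint]
  refine integral_congr_ae ?_
  filter_upwards [Measure.ae_ae_of_ae_prod hA, Measure.ae_ae_of_ae_prod hB] with z hzA hzB
  have hKz : Measurable fun u => K (U z, u) := hK.comp (by fun_prop)
  have hLz : Measurable fun v => L (V z, v) := hL.comp (by fun_prop)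
  exact congrArg (r z * ·) (hr _ _ hKz hLz
    (memLp_top_of_bound (hKz.comp hU).aestronglyMeasurable A hzA)
    (memLp_top_of_bound (hLz.comp hV).aestronglyMeasurable B hzB))

end Decoupling

section SignalSet

variable {p : ℕ} {Q : Measure (Sample p)} [IsProbabilityMeasure Q] {S : Finset (Fin p)}

omit [IsProbabilityMeasure Q] in
theorem measurable_subvector (T : Finset (Fin p)) : Measurable (subvector T) := by
  unfold subvector
  fun_prop

theorem IsSufficient.decouples_response (hS : IsSufficient Q S) (hY : MemLp Prod.snd ⊤ Q) :
    Decouples Q (subvector S) (subvector Sᶜ) Prod.snd := by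
  have hsub (T : Finset (Fin p)) :
      Measurable[MeasurableSpace.comap (Prod.fst : Sample p → _) inferInstance] (subvector T) := by
    have : Measurable fun (x : Fin p → ℝ) (i : T) => x i := by fun_prop
    exact this.comp (comap_measurable _)
  exact decouples_of_condExp_eq (hsub S).comap_le measurable_fst.comap_le (comap_measurable _)
    (hsub Sᶜ) hY hS.1 ((IndepFun_iff_Indep _ _ _).1 hS.2)

variable {μ : Measure ℝ≥0} [IsFiniteMeasure μ] {q : ℕ} [hq : Fact (q = 1 ∨ q = 2)]
  {C lam : ℝ} {β : Fin p → ℝ} {r : Sample p → ℝ}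

namespace IsKrrResidual

theorem decouples (hr : IsKrrResidual μ q Q lam β r) (hC : CommonBound μ q Q C)
    (hS : IsSufficient Q S) (hβS : ∀ j ∉ S, β j = 0) :
    Decouples Q (subvector S) (subvector Sᶜ) r := by
  obtain ⟨f, hf⟩ := hr.fitted
  let extend (u : S → ℝ) (i : Fin p) : ℝ := if h : i ∈ S then u ⟨i, h⟩ else 0
  have hextend : Measurable extend := measurable_pi_iff.2 fun i => by
    by_cases h : i ∈ S <;> simp only [extend, h, dite_true, dite_false] <;> fun_prop
  have rescale_extend (z : Sample p) :
      rescale q β z.1 = rescale q β (extend (subvector S z)) := by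
    funext i
    by_cases h : i ∈ S
    · simp [rescale, extend, h, subvector]
    · rw [rescale, rescale, hβS i h,
        Real.zero_rpow (by simpa using ne_zero_of_eq_one_or_eq_two hq.out), zero_mul, zero_mul]
  have hfit : Measurable fun u => f (rescale q β (extend u)) :=
    (continuous_kernelSpace hC.mass_le f).measurable.comp ((measurable_rescale q β).comp hextend)
  have hfit' : MemLp (fun z => f (rescale q β (extend (subvector S z)))) ⊤ Q :=
    memLp_top_of_bound (hfit.comp (measurable_subvector S)).aestronglyMeasurable _
      (.of_forall fun z => abs_apply_le f _)
  simp only [rescale_extend] at hf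
  rw [funext hf]
  exact (hS.decouples_response hC.memLp_response).sub (decouples_comp hfit hfit' hS.2)
    hC.memLp_response hfit'

theorem krrGradient_eq_of_notMem (hr : IsKrrResidual μ q Q lam β r) (hC : CommonBound μ q Q C)
    (hβ : ∀ i, 0 ≤ β i) (hS : IsSufficient Q S) (hβS : ∀ j ∉ S, β j = 0) {j : Fin p}
    (hj : j ∉ S) : krrGradient μ q Q lam β r j = 1 / (2 * lam) *
      (kernelForm Q (pairKernel μ 1 q β) r r * ∫ w, coordGap q j w ∂(Q.prod Q)) := by
  have weightedGap_eq (w : Sample p × Sample p) : weightedGap q β w =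
      ∑ i : S, β i * |subvector S w.1 i - subvector S w.2 i| ^ q := by
    rw [weightedGap, ← Finset.sum_subset (Finset.subset_univ S)
      (fun i _ hi => by rw [hβS i hi, zero_mul]), ← Finset.sum_coe_sort]
    rfl
  let K (u : (S → ℝ) × (S → ℝ)) : ℝ := laplaceMoment μ 1 (∑ i : S, β i * |u.1 i - u.2 i| ^ q)
  let L (v : (↥Sᶜ → ℝ) × (↥Sᶜ → ℝ)) : ℝ :=
    |v.1 ⟨j, Finset.mem_compl.2 hj⟩ - v.2 ⟨j, Finset.mem_compl.2 hj⟩| ^ q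
  have kernel_eq (w : Sample p × Sample p) :
      pairKernel μ 1 q β w = K (subvector S w.1, subvector S w.2) := by
    simp only [K, pairKernel, weightedGap_eq]
  have hK : Measurable K := (continuous_laplaceMoment hC.mass_le 1).measurable.comp (by fun_prop)
  have hKle : ∀ᵐ w ∂(Q.prod Q), |K (subvector S w.1, subvector S w.2)| ≤ C :=
    .of_forall fun w => by
      rw [← kernel_eq, abs_of_nonneg (pairKernel_nonneg _ _ _ _ _)]
      exact (pairKernel_le hC.mass_le 1 q hβ w).trans (hC.moment_le 1 one_le_two)
  have hLle : ∀ᵐ w ∂(Q.prod Q), |L (subvector Sᶜ w.1, subvector Sᶜ w.2)| ≤ C :=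
    hC.coordGap_le.mono fun w hw => by
      rw [abs_of_nonneg (by positivity)]
      exact hw j
  have h := (hr.decouples hC hS hβS).kernelForm_mul hr.memLp (measurable_subvector S)
    (measurable_subvector Sᶜ) hK (by fun_prop) hKle hLle
  simp only [← kernel_eq] at h
  exact congrArg (1 / (2 * lam) * ·) h

end IsKrrResidual

theorem integral_coordGap_pos {q : ℕ} (hq : q ≠ 0) {j : Fin p}
    (hgap : MemLp (coordGap q j) ⊤ (Q.prod Q))
    (hvar : 0 < variance (fun z : Sample p => z.1 j) Q) :
    0 < ∫ w, coordGap q j w ∂(Q.prod Q) := by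
  refine (integral_nonneg fun w => coordGap_nonneg q j w).lt_of_ne fun h => hvar.ne' ?_
  have gap_eq_zero := (integral_eq_zero_iff_of_nonneg (fun w => coordGap_nonneg q j w)
    (hgap.integrable le_top)).1 h.symm
  obtain ⟨z, hz⟩ := (Measure.ae_ae_of_ae_prod gap_eq_zero).exists
  have coord_const : (fun z : Sample p => z.1 j) =ᵐ[Q] fun _ => z.1 j := by
    filter_upwards [hz] with z' hz'
    exact (sub_eq_zero.1 (abs_eq_zero.1 ((pow_eq_zero_iff hq).1 hz'))).symm
  rw [variance_congr coord_const, variance_eq_integral measurable_const.aemeasurable]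
  simp

end SignalSet

/-! ### A criterion for self-penalization -/

section Criterion

variable {p : ℕ}

section FeasibleSet

theorem feasibleSet_eq_pi (p : ℕ) (M : ℝ) :
    feasibleSet p M = Set.univ.pi fun _ : Fin p => Set.Icc 0 M := by
  ext β
  simp only [feasibleSet, Set.mem_ofPred_eq, Set.mem_univ_pi, Set.mem_Icc]
  exact ⟨fun h i => ⟨h.1 i, (le_abs_self _).trans (h.2 i)⟩,
    fun h => ⟨fun i => (h i).1, fun i => (abs_of_nonneg (h i).1).trans_le (h i).2⟩⟩

theorem isCompact_feasibleSet (p : ℕ) (M : ℝ) : IsCompact (feasibleSet p M) := by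
  rw [feasibleSet_eq_pi]
  exact isCompact_univ_pi fun _ => isCompact_Icc

theorem convex_feasibleSet (p : ℕ) (M : ℝ) : Convex ℝ (feasibleSet p M) := by
  rw [feasibleSet_eq_pi]
  exact convex_pi fun _ _ => convex_Icc _ _

theorem interior_feasibleSet (p : ℕ) (M : ℝ) :
    interior (feasibleSet p M) = Set.univ.pi fun _ : Fin p => Set.Ioo 0 M := by
  simp only [feasibleSet_eq_pi, interior_pi_set Set.finite_univ, interior_Icc]

variable {M : ℝ} (hM : 0 < M)
include hM

theorem nonempty_interior_feasibleSet (p : ℕ) : (interior (feasibleSet p M)).Nonempty := by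
  rw [interior_feasibleSet]
  exact ⟨fun _ => M / 2, fun i _ => ⟨half_pos hM, half_lt_self hM⟩⟩

theorem uniqueDiffOn_feasibleSet (p : ℕ) : UniqueDiffOn ℝ (feasibleSet p M) :=
  uniqueDiffOn_convex (convex_feasibleSet p M) (nonempty_interior_feasibleSet hM p)

theorem closure_interior_feasibleSet (p : ℕ) :
    closure (interior (feasibleSet p M)) = feasibleSet p M := by
  rw [(convex_feasibleSet p M).closure_interior_eq_closure_of_nonempty_interior
    (nonempty_interior_feasibleSet hM p), (isCompact_feasibleSet p M).isClosed.closure_eq]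

omit hM in
/-- The face of the feasible set on which the weights are carried by `S`. -/
def feasibleFace (S : Finset (Fin p)) (M : ℝ) : Set (Fin p → ℝ) :=
  {β ∈ feasibleSet p M | ∀ j ∉ S, β j = 0}

omit hM in
theorem isCompact_feasibleFace (S : Finset (Fin p)) (M : ℝ) : IsCompact (feasibleFace S M) := by
  have : feasibleFace S M = feasibleSet p M ∩ ⋂ j ∈ Sᶜ, {β : Fin p → ℝ | β j = 0} := by
    ext β
    simp [feasibleFace]
  rw [this]
  exact (isCompact_feasibleSet p M).inter_right (isClosed_biInter fun j _ =>
    isClosed_eq (continuous_apply j) continuous_const)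

omit hM in
theorem convex_feasibleFace (S : Finset (Fin p)) (M : ℝ) : Convex ℝ (feasibleFace S M) :=
  (convex_feasibleSet p M).inter fun x hx y hy a b _ _ _ j hj => by simp [hx j hj, hy j hj]

theorem piecewise_mem_feasibleFace (S : Finset (Fin p)) {β : Fin p → ℝ}
    (hβ : β ∈ feasibleSet p M) : S.piecewise β 0 ∈ feasibleFace S M := by
  refine ⟨⟨fun i => ?_, fun i => ?_⟩, fun j hj => S.piecewise_eq_of_notMem β 0 hj⟩ <;>
    by_cases hi : i ∈ S
  · simpa [hi] using hβ.1 i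
  · simp [hi]
  · simpa [hi] using hβ.2 i
  · simpa [hi] using hM.le

omit hM in
theorem sum_abs_sub_piecewise (S : Finset (Fin p)) (β : Fin p → ℝ) :
    ∑ i, |β i - S.piecewise β 0 i| = ∑ j ∈ Sᶜ, |β j| := by
  rw [← Finset.sum_add_sum_compl S, Finset.sum_eq_zero fun j hj => by simp [hj], zero_add]
  exact Finset.sum_congr rfl fun j hj => by simp [Finset.mem_compl.1 hj]

end FeasibleSet

section Gradient

theorem sum_abs_sub_le (β γ : Fin p → ℝ) : ∑ i, |γ i - β i| ≤ p * ‖γ - β‖ :=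
  (Finset.sum_le_card_nsmul _ _ ‖γ - β‖ fun i _ => norm_le_pi_norm (γ - β) i).trans_eq (by simp)

theorem locallyLipschitzOn_of_abs_sub_le {D : Set (Fin p → ℝ)} {F : (Fin p → ℝ) → ℝ} {L : ℝ}
    (hL : 0 ≤ L) (hF : ∀ β ∈ D, ∀ γ ∈ D, |F γ - F β| ≤ L * ∑ i, |γ i - β i|) :
    LocallyLipschitzOn D F := by
  have : LipschitzOnWith (L * p).toNNReal F D := LipschitzOnWith.of_dist_le_mul fun γ hγ β hβ => by
    rw [Real.coe_toNNReal _ (by positivity), dist_eq_norm, dist_eq_norm, Real.norm_eq_abs,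
      mul_assoc]
    exact (hF β hβ γ hγ).trans (mul_le_mul_of_nonneg_left (sum_abs_sub_le β γ) hL)
  exact fun _ _ => ⟨_, D, self_mem_nhdsWithin, this⟩

/-- The linear functional `η ↦ ∑ j, η j * g j` with gradient `g`. -/
noncomputable def gradientFunctional (g : Fin p → ℝ) : (Fin p → ℝ) →L[ℝ] ℝ :=
  ∑ j, g j • ContinuousLinearMap.proj j

theorem gradientFunctional_apply (g η : Fin p → ℝ) :
    gradientFunctional g η = ∑ j, η j * g j := by
  simp [gradientFunctional, mul_comm]

/-- `G` is the gradient of `F` on `D`, where derivatives are taken along `D`. -/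
def HasGradientOn (F : (Fin p → ℝ) → ℝ) (G : (Fin p → ℝ) → Fin p → ℝ)
    (D : Set (Fin p → ℝ)) : Prop :=
  ∀ β ∈ D, HasFDerivWithinAt F (gradientFunctional (G β)) D β

variable {D : Set (Fin p → ℝ)} {F : (Fin p → ℝ) → ℝ} {G : (Fin p → ℝ) → Fin p → ℝ}

theorem hasGradientOn_of_quadratic_remainder {K : ℝ} (hK : 0 ≤ K)
    (hF : ∀ β ∈ D, ∀ γ ∈ D,
      |F γ - F β - ∑ j, (γ j - β j) * G β j| ≤ K * (∑ i, |γ i - β i|) ^ 2) :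
    HasGradientOn F G D := by
  intro β hβ
  rw [hasFDerivWithinAt_iff_isLittleO]
  have remainder_isBigO : (fun γ => F γ - F β - gradientFunctional (G β) (γ - β)) =O[𝓝[D] β]
      fun γ => ‖γ - β‖ ^ 2 := by
    refine Asymptotics.IsBigO.of_bound (K * (p : ℝ) ^ 2) ?_
    filter_upwards [self_mem_nhdsWithin] with γ hγ
    rw [gradientFunctional_apply, norm_pow, norm_norm, mul_assoc, ← mul_pow]
    refine (hF β hβ γ hγ).trans ?_
    gcongr
    exact sum_abs_sub_le β γ
  refine remainder_isBigO.trans_isLittleO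
    (((Asymptotics.isLittleO_norm_pow_id one_lt_two).comp_tendsto ?_).mono nhdsWithin_le_nhds)
  have : Continuous fun γ : Fin p → ℝ => γ - β := by fun_prop
  simpa using this.tendsto β

namespace HasGradientOn

theorem continuousOn (h : HasGradientOn F G D) : ContinuousOn F D :=
  fun β hβ => (h β hβ).continuousWithinAt

theorem partialDeriv_eq (h : HasGradientOn F G D) (hD : UniqueDiffOn ℝ D) {β : Fin p → ℝ}
    (hβ : β ∈ D) : partialDeriv F D β = G β := by
  funext j
  rw [partialDeriv, (h β hβ).fderivWithin (hD β hβ), gradientFunctional_apply]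
  simp [Pi.single_apply]

theorem mem_clarkeSubdifferential (h : HasGradientOn F G D) (hG : ContinuousOn G D)
    (hD : UniqueDiffOn ℝ D) {β : Fin p → ℝ} (hβ : β ∈ D) (hcl : β ∈ closure (interior D)) :
    G β ∈ clarkeSubdifferential F D β := by
  obtain ⟨b, hb, hlim⟩ := mem_closure_iff_seq_limit.1 hcl
  have hbD : ∀ k, b k ∈ D := fun k => interior_subset (hb k)
  refine subset_convexHull ℝ _ ⟨b, fun k => ⟨hb k, ?_⟩, hlim, ?_⟩
  · exact ((h (b k) (hbD k)).hasFDerivAt (mem_interior_iff_mem_nhds.1 (hb k))).differentiableAt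
  · simp only [h.partialDeriv_eq hD (hbD _)]
    exact (hG β hβ).tendsto.comp (tendsto_nhdsWithin_iff.2 ⟨hlim, .of_forall hbD⟩)

/-- Moving from `β` towards the restriction of a feasible `γ` to `S` stays in the face, where the
minimality of `β` controls the gradient; the remaining coordinates of `γ` are penalized by `G`. -/
theorem mem_stationaryPoints {M : ℝ} (hM : 0 < M) (h : HasGradientOn F G (feasibleSet p M))
    (hG : ContinuousOn G (feasibleSet p M)) {S : Finset (Fin p)} {β : Fin p → ℝ}
    (hβ : β ∈ feasibleFace S M) (hmin : IsMinOn F (feasibleFace S M) β)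
    (hGβ : ∀ j ∉ S, 0 ≤ G β j) : β ∈ stationaryPoints F (feasibleSet p M) := by
  refine ⟨hβ.1, G β, h.mem_clarkeSubdifferential hG (uniqueDiffOn_feasibleSet hM p) hβ.1
    ((closure_interior_feasibleSet hM p).symm ▸ hβ.1), -G β, fun γ hγ => ?_, add_neg_cancel _⟩
  have variational : 0 ≤ gradientFunctional (G β) (S.piecewise γ 0 - β) :=
    hmin.localize.hasFDerivWithinAt_nonneg ((h β hβ.1).mono fun x hx => hx.1)
      (sub_mem_posTangentConeAt_of_segment_subset
        ((convex_feasibleFace S M).segment_subset hβ (piecewise_mem_feasibleFace hM S hγ)))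
  have restriction_le : gradientFunctional (G β) (S.piecewise γ 0 - β) ≤
      ∑ j, (γ j - β j) * G β j := by
    rw [gradientFunctional_apply]
    refine Finset.sum_le_sum fun j _ => ?_
    by_cases hj : j ∈ S
    · simp [hj]
    · simpa [hj, hβ.2 j hj] using mul_nonneg (hγ.1 j) (hGβ j hj)
  simpa [mul_comm] using variational.trans restriction_le

end HasGradientOn

end Gradient

section LevelSet

variable {F : (Fin p → ℝ) → ℝ} {G : (Fin p → ℝ) → Fin p → ℝ} {S : Finset (Fin p)} {M c δ lam : ℝ}

theorem exists_isOpen_levelSet_eq {D : Set (Fin p → ℝ)} (hF : ContinuousOn F D)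
    (S : Finset (Fin p)) (c δ lam : ℝ) :
    ∃ U : Set (Fin p → ℝ), IsOpen U ∧ levelSet S D F c δ lam = U ∩ D := by
  obtain ⟨U, hU, hUD⟩ := continuousOn_iff'.1 hF (Set.Iio (F 0 - c)) isOpen_Iio
  have hV : IsOpen {β : Fin p → ℝ | ∑ j ∈ Sᶜ, |β j| < δ * c ^ 2 * lam ^ 3} :=
    isOpen_lt (by fun_prop) continuous_const
  refine ⟨_, hU.inter hV, ?_⟩
  ext β
  have h := Set.ext_iff.1 hUD β
  simp only [Set.mem_inter_iff, Set.mem_preimage, Set.mem_Iio, lt_sub_comm] at h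
  simp only [levelSet, Set.mem_ofPred_eq, Set.mem_inter_iff]
  tauto

theorem subset_closure_setOf_pos (hM : 0 < M) {U : Set (Fin p → ℝ)} (hU : IsOpen U) :
    U ∩ feasibleSet p M ⊆ closure {β ∈ U ∩ feasibleSet p M | ∀ j, 0 < β j} := by
  rintro β ⟨hβU, hβ⟩
  rw [← closure_interior_feasibleSet hM p] at hβ
  refine closure_mono ?_ (hU.inter_closure ⟨hβU, hβ⟩)
  rintro γ ⟨hγU, hγ⟩
  refine ⟨⟨hγU, interior_subset hγ⟩, fun j => ?_⟩
  rw [interior_feasibleSet] at hγ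
  exact (hγ j trivial).1

/-- The stationary point is a minimizer of `F` over the face of weights carried by `S`. -/
theorem selfPenalizing_levelSet_of_hasGradientOn (hM : 0 < M)
    (hlip : LocallyLipschitzOn (feasibleSet p M) F) (hF : HasGradientOn F G (feasibleSet p M))
    (hG : ContinuousOn G (feasibleSet p M))
    (hpos : ∀ β ∈ feasibleFace S M, ∀ j ∉ S, 0 ≤ G β j) {κ : ℝ} (hκ : 0 < κ)
    (hGκ : ∀ β ∈ levelSet S (feasibleSet p M) F c δ lam, ∀ j ∉ S, κ ≤ G β j)
    (hface : (levelSet S (feasibleSet p M) F c δ lam ∩ feasibleFace S M).Nonempty) :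
    SelfPenalizing S (feasibleSet p M) F (levelSet S (feasibleSet p M) F c δ lam) := by
  set B := levelSet S (feasibleSet p M) F c δ lam
  obtain ⟨U, hU, hBU⟩ : ∃ U, IsOpen U ∧ B = U ∩ feasibleSet p M :=
    exists_isOpen_levelSet_eq hF.continuousOn S c δ lam
  refine ⟨hlip, ⟨U, hU, hBU⟩, ⟨{β ∈ B | ∀ j, 0 < β j}, fun β hβ => hβ.1, ?_,
    fun β hβ => (hF β hβ.1.1).differentiableWithinAt, κ, hκ, fun j hj β hβ => ?_⟩, ?_⟩
  · rw [hBU]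
    exact subset_closure_setOf_pos hM hU
  · rw [Real.sign_of_pos (hβ.2 j), one_mul,
      hF.partialDeriv_eq (uniqueDiffOn_feasibleSet hM p) hβ.1.1]
    exact hGκ β hβ.1 j hj
  · obtain ⟨β, hβB, hβ⟩ := hface
    obtain ⟨b, hb, hmin⟩ := (isCompact_feasibleFace S M).exists_isMinOn ⟨β, hβ⟩
      (hF.continuousOn.mono fun x hx => hx.1)
    have sum_eq_zero {γ : Fin p → ℝ} (hγ : γ ∈ feasibleFace S M) : ∑ j ∈ Sᶜ, |γ j| = 0 :=
      Finset.sum_eq_zero fun j hj => by rw [hγ.2 j (Finset.mem_compl.1 hj), abs_zero]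
    refine ⟨b, ⟨hb.1, ?_, ?_⟩, hF.mem_stationaryPoints hM hG hb hmin (hpos b hb), fun j hj => ?_⟩
    · exact hβB.2.1.trans_le (sub_le_sub_left (hmin hβ) _)
    · rw [sum_eq_zero hb, ← sum_eq_zero hβ]
      exact hβB.2.2
    · exact not_imp_comm.1 (hb.2 j) hj

end LevelSet

end Criterion

/-! ### The objective is self-penalizing -/

section SelfPenalization

variable {p : ℕ}

/-- `F` has `G` as its gradient on `D`, with explicit constants, in the `ℓ₁` norm, for the
Lipschitz continuity of `F` and of `G` and for the Taylor remainder. -/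
structure HasLipschitzGradient (F : (Fin p → ℝ) → ℝ) (G : (Fin p → ℝ) → Fin p → ℝ)
    (D : Set (Fin p → ℝ)) (L K : ℝ) : Prop where
  abs_sub_le : ∀ β ∈ D, ∀ γ ∈ D, |F γ - F β| ≤ L * ∑ i, |γ i - β i|
  abs_taylor_le : ∀ β ∈ D, ∀ γ ∈ D,
    |F γ - F β - ∑ j, (γ j - β j) * G β j| ≤ K * (∑ i, |γ i - β i|) ^ 2
  abs_gradient_sub_le : ∀ β ∈ D, ∀ γ ∈ D, ∀ j, |G γ j - G β j| ≤ 2 * K * ∑ i, |γ i - β i|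

namespace HasLipschitzGradient

variable {F : (Fin p → ℝ) → ℝ} {G : (Fin p → ℝ) → Fin p → ℝ} {D : Set (Fin p → ℝ)} {L K : ℝ}

theorem continuousOn_gradient (h : HasLipschitzGradient F G D L K) (hK : 0 ≤ K) :
    ContinuousOn G D :=
  continuousOn_pi.2 fun j => (locallyLipschitzOn_of_abs_sub_le (mul_nonneg zero_le_two hK)
    fun β hβ γ hγ => h.abs_gradient_sub_le β hβ γ hγ j).continuousOn

variable {S : Finset (Fin p)} {M κ : ℝ} {β : Fin p → ℝ}

theorem piecewise_gain (h : HasLipschitzGradient F G (feasibleSet p M) L K) (hM : 0 < M)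
    (hβ : β ∈ feasibleSet p M) {c : ℝ} (hgain : c ≤ F 0 - F β)
    (hL : L * ∑ j ∈ Sᶜ, |β j| ≤ c / 2) : c / 2 ≤ F 0 - F (S.piecewise β 0) := by
  have hsub := h.abs_sub_le _ (piecewise_mem_feasibleFace hM S hβ).1 β hβ
  rw [sum_abs_sub_piecewise] at hsub
  linarith [(abs_le.1 (hsub.trans hL)).1]

theorem le_gradient_of_piecewise (h : HasLipschitzGradient F G (feasibleSet p M) L K)
    (hM : 0 < M) (hβ : β ∈ feasibleSet p M) (hK : 2 * K * ∑ j ∈ Sᶜ, |β j| ≤ κ) {j : Fin p}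
    (hG : 2 * κ ≤ G (S.piecewise β 0) j) : κ ≤ G β j := by
  have hsub := h.abs_gradient_sub_le _ (piecewise_mem_feasibleFace hM S hβ).1 β hβ j
  rw [sum_abs_sub_piecewise] at hsub
  linarith [(abs_le.1 (hsub.trans hK)).1]

theorem piecewise_le (h : HasLipschitzGradient F G (feasibleSet p M) L K)
    (hM : 0 < M) (hβ : β ∈ feasibleSet p M) (hK : K * ∑ j ∈ Sᶜ, |β j| ≤ κ)
    (hG : ∀ j ∉ S, κ ≤ G (S.piecewise β 0) j) : F (S.piecewise β 0) ≤ F β := by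
  set π := S.piecewise β 0
  have htaylor := h.abs_taylor_le π (piecewise_mem_feasibleFace hM S hβ).1 β hβ
  rw [sum_abs_sub_piecewise] at htaylor
  have linear_part : κ * ∑ j ∈ Sᶜ, |β j| ≤ ∑ j, (β j - π j) * G π j := by
    rw [← Finset.sum_add_sum_compl S, Finset.sum_eq_zero (s := S) fun j hj => by simp [π, hj],
      zero_add, Finset.mul_sum]
    refine Finset.sum_le_sum fun j hj => ?_
    have hjS := Finset.mem_compl.1 hj
    have hπ : π j = 0 := S.piecewise_eq_of_notMem β 0 hjS
    rw [hπ, sub_zero, abs_of_nonneg (hβ.1 j), mul_comm]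
    exact mul_le_mul_of_nonneg_left (hG j hjS) (hβ.1 j)
  have remainder_le : K * (∑ j ∈ Sᶜ, |β j|) ^ 2 ≤ κ * ∑ j ∈ Sᶜ, |β j| := by
    rw [sq, ← mul_assoc]
    gcongr
  linarith [(abs_le.1 (htaylor.trans remainder_le)).1]

/-- Zeroing the weights off `S` costs little of the gain, so the lower bound on the gradient holds
first at the zeroed weights and then, by Lipschitz continuity, at the original ones. -/
theorem selfPenalizing_levelSet (h : HasLipschitzGradient F G (feasibleSet p M) L K) (hM : 0 < M)
    (hL₀ : 0 ≤ L) (hK₀ : 0 ≤ K) (hκ : 0 < κ) {c δ lam : ℝ}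
    (hnonneg : ∀ β ∈ feasibleFace S M, ∀ j ∉ S, 0 ≤ G β j)
    (hpen : ∀ β ∈ feasibleFace S M, c / 2 ≤ F 0 - F β → ∀ j ∉ S, 2 * κ ≤ G β j)
    (hL : L * (δ * c ^ 2 * lam ^ 3) ≤ c / 2) (hK : 2 * K * (δ * c ^ 2 * lam ^ 3) ≤ κ)
    (hne : (levelSet S (feasibleSet p M) F c δ lam).Nonempty) :
    SelfPenalizing S (feasibleSet p M) F (levelSet S (feasibleSet p M) F c δ lam) := by
  have hpen_piecewise : ∀ β ∈ levelSet S (feasibleSet p M) F c δ lam, ∀ j ∉ S,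
      2 * κ ≤ G (S.piecewise β 0) j := fun β ⟨hβ, hgain, hsmall⟩ =>
    hpen _ (piecewise_mem_feasibleFace hM S hβ) (h.piecewise_gain hM hβ hgain.le
      ((mul_le_mul_of_nonneg_left hsmall.le hL₀).trans hL))
  refine selfPenalizing_levelSet_of_hasGradientOn hM
    (locallyLipschitzOn_of_abs_sub_le hL₀ h.abs_sub_le)
    (hasGradientOn_of_quadratic_remainder hK₀ h.abs_taylor_le) (h.continuousOn_gradient hK₀)
    hnonneg hκ (fun β hβ j hj => ?_) ?_
  · exact h.le_gradient_of_piecewise hM hβ.1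
      ((mul_le_mul_of_nonneg_left hβ.2.2.le (by positivity)).trans hK) (hpen_piecewise β hβ j hj)
  · obtain ⟨β, hβ⟩ := hne
    have hface := piecewise_mem_feasibleFace hM S hβ.1
    have hle : F (S.piecewise β 0) ≤ F β := by
      refine h.piecewise_le hM hβ.1 ?_ (hpen_piecewise β hβ)
      linarith [mul_le_mul_of_nonneg_left hβ.2.2.le (by positivity : 0 ≤ 2 * K)]
    have sum_piecewise : ∑ j ∈ Sᶜ, |S.piecewise β 0 j| = 0 :=
      Finset.sum_eq_zero fun j hj => by rw [hface.2 j (Finset.mem_compl.1 hj), abs_zero]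
    refine ⟨S.piecewise β 0, ⟨hface.1, hβ.2.1.trans_le (sub_le_sub_left hle _), ?_⟩, hface⟩
    rw [sum_piecewise]
    exact (Finset.sum_nonneg fun j _ => abs_nonneg (β j)).trans_lt hβ.2.2

end HasLipschitzGradient

section KernelRidge

variable {μ : Measure ℝ≥0} [IsFiniteMeasure μ] {q : ℕ} [hq : Fact (q = 1 ∨ q = 2)]
  {Q : Measure (Sample p)} [IsProbabilityMeasure Q] {C m v M c δ lam : ℝ} {S : Finset (Fin p)}

theorem hasLipschitzGradient_krrObjective (hC : CommonBound μ q Q C) (hlam : 0 < lam)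
    (hlam1 : lam ≤ 1) {D : Set (Fin p → ℝ)} (hD : ∀ β ∈ D, ∀ i, 0 ≤ β i)
    {r : (Fin p → ℝ) → Sample p → ℝ} (hr : ∀ β ∈ D, IsKrrResidual μ q Q lam β (r β)) :
    HasLipschitzGradient (krrObjective μ q Q lam) (fun β => krrGradient μ q Q lam β (r β)) D
      (C ^ 4 / lam) (C ^ 6 / lam ^ 2) where
  abs_sub_le β hβ γ hγ :=
    (hr β hβ).abs_krrObjective_sub_le (hr γ hγ) hC hlam (hD β hβ) (hD γ hγ)
  abs_taylor_le β hβ γ hγ :=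
    (hr β hβ).abs_krrObjective_taylor_le (hr γ hγ) hC hlam hlam1 (hD β hβ) (hD γ hγ)
  abs_gradient_sub_le β hβ γ hγ j := by
    have := (hr β hβ).abs_krrGradient_sub_le (hr γ hγ) hC hlam hlam1 (hD β hβ) (hD γ hγ) j
    rwa [mul_div_assoc] at this

namespace IsKrrResidual

variable {r : Sample p → ℝ} {β : Fin p → ℝ} {j : Fin p}

theorem krrGradient_nonneg_of_notMem (hr : IsKrrResidual μ q Q lam β r)
    (hC : CommonBound μ q Q C) (hlam : 0 < lam) (hβ : ∀ i, 0 ≤ β i) (hS : IsSufficient Q S)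
    (hβS : ∀ j ∉ S, β j = 0) (hj : j ∉ S) : 0 ≤ krrGradient μ q Q lam β r j := by
  have hzero_le : ∀ᵐ t : ℝ≥0 ∂μ, (0 : ℝ) ≤ t := .of_forall fun t => t.2
  have form_one_nonneg : 0 ≤ kernelForm Q (pairKernel μ 1 q β) r r := by
    simpa using mul_kernelForm_le_kernelForm_one hC.mass_le hzero_le hβ hr.memLp
  rw [hr.krrGradient_eq_of_notMem hC hβ hS hβS hj]
  exact mul_nonneg (by positivity)
    (mul_nonneg form_one_nonneg (integral_nonneg fun w => coordGap_nonneg q j w))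

theorem le_krrGradient_of_notMem (hr : IsKrrResidual μ q Q lam β r) (hC : CommonBound μ q Q C)
    (hlam : 0 < lam) (hβ : ∀ i, 0 ≤ β i) (hcent : ∫ z, z.2 ∂Q = 0) (hS : IsSufficient Q S)
    (hβS : ∀ j ∉ S, β j = 0) (hm₀ : 0 ≤ m) (hm : ∀ᵐ t : ℝ≥0 ∂μ, m ≤ (t : ℝ)) (hv₀ : 0 ≤ v)
    (hv : v ≤ ∫ w, coordGap q j w ∂(Q.prod Q)) (hc : 0 ≤ c)
    (hgain : c ≤ krrObjective μ q Q lam 0 - krrObjective μ q Q lam β) (hj : j ∉ S) :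
    2 * m * v / C ^ 3 * (lam * c ^ 2) ≤ krrGradient μ q Q lam β r j := by
  have hC₀ := hC.pos
  have form_one_ge : m * (4 * lam ^ 2 * c ^ 2 / C ^ 3) ≤ kernelForm Q (pairKernel μ 1 q β) r r :=
    (mul_le_mul_of_nonneg_left (hr.le_kernelForm_self hC hlam hβ hcent hc hgain) hm₀).trans
      (mul_kernelForm_le_kernelForm_one hC.mass_le hm hβ hr.memLp)
  rw [hr.krrGradient_eq_of_notMem hC hβ hS hβS hj]
  calc 2 * m * v / C ^ 3 * (lam * c ^ 2)
      = 1 / (2 * lam) * (m * (4 * lam ^ 2 * c ^ 2 / C ^ 3) * v) := by field_simp; ring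
    _ ≤ _ := by
        refine mul_le_mul_of_nonneg_left ?_ (by positivity)
        exact mul_le_mul form_one_ge hv hv₀ (le_trans (by positivity) form_one_ge)

end IsKrrResidual

theorem krrObjective_zero_le (hC : CommonBound μ q Q C) (hlam : 0 < lam)
    (hcent : ∫ z, z.2 ∂Q = 0) : krrObjective μ q Q lam 0 ≤ C ^ 2 := by
  have second_moment_le : ∫ z, z.2 * z.2 ∂Q ≤ C ^ 2 := by
    refine (integral_mono_ae ((memLp_top_mul hC.memLp_response hC.memLp_response).integrable le_top)
      (integrable_const (C ^ 2)) ?_).trans_eq (by simp)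
    filter_upwards [hC.response_le] with z hz
    simpa [sq] using sq_le_sq' (abs_le.1 hz).1 (abs_le.1 hz).2
  rw [krrObjective_zero hC hlam hcent]
  linarith [sq_nonneg C]

theorem le_sq_of_levelSet_nonempty (hC : CommonBound μ q Q C) (hlam : 0 < lam)
    (hcent : ∫ z, z.2 ∂Q = 0) {D : Set (Fin p → ℝ)}
    (hne : (levelSet S D (krrObjective μ q Q lam) c δ lam).Nonempty) : c ≤ C ^ 2 := by
  obtain ⟨β, -, hgain, -⟩ := hne
  linarith [krrObjective_nonneg (μ := μ) (q := q) Q hlam.le β,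
    krrObjective_zero_le (q := q) hC hlam hcent]

theorem selfPenalizing_levelSet_krrObjective (hM : 0 < M) (hC : CommonBound μ q Q C)
    (hcent : ∫ z, z.2 ∂Q = 0) (hS : IsSufficient Q S) (hm₀ : 0 < m)
    (hm : ∀ᵐ t : ℝ≥0 ∂μ, m ≤ (t : ℝ)) (hv₀ : 0 < v)
    (hv : ∀ j, v ≤ ∫ w, coordGap q j w ∂(Q.prod Q)) (hc : 0 < c) (hδ : 0 < δ) (hlam : 0 < lam)
    (hlam1 : lam ≤ 1) (hδ_gain : C ^ 6 * δ ≤ 1 / 2) (hδ_gradient : 8 * C ^ 9 * δ ≤ m * v)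
    (hne : (levelSet S (feasibleSet p M) (krrObjective μ q Q lam) c δ lam).Nonempty) :
    SelfPenalizing S (feasibleSet p M) (krrObjective μ q Q lam)
      (levelSet S (feasibleSet p M) (krrObjective μ q Q lam) c δ lam) := by
  have hC₀ := hC.pos
  choose! r hr using fun (β : Fin p → ℝ) (hβ : β ∈ feasibleSet p M) =>
    exists_isKrrResidual (q := q) hC.mass_le hC.memLp_response hlam hβ.1
  refine (hasLipschitzGradient_krrObjective hC hlam hlam1 (fun β hβ => hβ.1)
    hr).selfPenalizing_levelSet hM (κ := m * v / (4 * C ^ 3) * (lam * c ^ 2)) (by positivity)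
    (by positivity) (by positivity) (fun β hβ j hj => ?_) (fun β hβ hgain j hj => ?_) ?_ ?_ hne
  · exact (hr β hβ.1).krrGradient_nonneg_of_notMem hC hlam hβ.1.1 hS hβ.2 hj
  · refine le_trans (le_of_eq ?_) ((hr β hβ.1).le_krrGradient_of_notMem hC hlam hβ.1.1 hcent hS
      hβ.2 hm₀.le hm hv₀.le (hv j) (half_pos hc).le hgain hj)
    field_simp
    ring
  · calc C ^ 4 / lam * (δ * c ^ 2 * lam ^ 3) = C ^ 4 * δ * c * c * lam ^ 2 := by field_simp
      _ ≤ C ^ 4 * δ * c * C ^ 2 * 1 := by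
        gcongr
        · exact le_sq_of_levelSet_nonempty hC hlam hcent hne
        · exact pow_le_one₀ hlam.le hlam1
      _ = C ^ 6 * δ * c := by ring
      _ ≤ 1 / 2 * c := by gcongr
      _ = c / 2 := by ring
  · calc 2 * (C ^ 6 / lam ^ 2) * (δ * c ^ 2 * lam ^ 3)
        = 8 * C ^ 9 * δ / (4 * C ^ 3) * (lam * c ^ 2) := by field_simp; ring
      _ ≤ m * v / (4 * C ^ 3) * (lam * c ^ 2) := by gcongr

theorem exists_forall_selfPenalizing_levelSet [Nonempty (Fin p)] (hM : 0 < M)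
    (hμ : KernelAssumption μ) (hQ : DistributionAssumption Q) (hS : IsSufficient Q S) :
    ∃ δ₀ > 0, ∀ c δ lam : ℝ, 0 < c → 0 < δ → 0 < lam → δ ≤ δ₀ → lam ≤ 1 →
      (levelSet S (feasibleSet p M) (krrObjective μ q Q lam) c δ lam).Nonempty →
        SelfPenalizing S (feasibleSet p M) (krrObjective μ q Q lam)
          (levelSet S (feasibleSet p M) (krrObjective μ q Q lam) c δ lam) := by
  obtain ⟨C, hC⟩ := exists_commonBound hμ q hQ
  obtain ⟨m, _, hm₀, hm⟩ := hμ.ae_mem_Icc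
  obtain ⟨j, hj⟩ := Finite.exists_min fun j => ∫ w, coordGap q j w ∂(Q.prod Q)
  set v := ∫ w, coordGap q j w ∂(Q.prod Q)
  have hC₀ := hC.pos
  have hv₀ : 0 < v := integral_coordGap_pos (ne_zero_of_eq_one_or_eq_two hq.out)
    (hC.memLp_coordGap j) (hQ.variance_pos j)
  refine ⟨min (1 / (2 * C ^ 6)) (m * v / (8 * C ^ 9)), by positivity,
    fun c δ lam hc hδ hlam hδ₀ hlam1 hne => ?_⟩
  refine selfPenalizing_levelSet_krrObjective hM hC hQ.centered hS hm₀ (hm.mono fun t ht => ht.1)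
    hv₀ hj hc hδ hlam hlam1 ?_ ?_ hne
  · have := (le_div_iff₀ (by positivity)).1 (hδ₀.trans (min_le_left _ _))
    linarith
  · have := (le_div_iff₀ (by positivity)).1 (hδ₀.trans (min_le_right _ _))
    linarith

end KernelRidge

end SelfPenalization

/-! ### Detection of the signal -/

section Moments

variable {Ω : Type*} {mΩ : MeasurableSpace Ω} {Q : Measure Ω}

theorem memLp_top_continuous_comp {E G : Type*} [NormedAddCommGroup E] [ProperSpace E]
    [NormedAddCommGroup G] {F : E → G} (hF : Continuous F) {X : Ω → E} (hX : MemLp X ⊤ Q) :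
    MemLp (fun z => F (X z)) ⊤ Q := by
  obtain ⟨B, hB⟩ :=
    (isCompact_closedBall (0 : E) (lpNorm X ⊤ Q)).exists_bound_of_continuousOn hF.continuousOn
  refine memLp_top_of_bound (hF.comp_aestronglyMeasurable hX.1) B ?_
  filter_upwards [ae_le_lpNorm_exponent_top hX] with z hz
  exact hB _ (mem_closedBall_zero_iff.2 hz)

variable [IsFiniteMeasure Q]

theorem hasDerivAt_integral_mul_comp_add_mul {φ φ' : ℝ → ℝ} (hφ : ∀ x, HasDerivAt φ (φ' x) x)
    (hφ' : Continuous φ') {w d e : Ω → ℝ} (hw : MemLp w ⊤ Q) (hd : MemLp d ⊤ Q) (he : MemLp e ⊤ Q)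
    (t : ℝ) :
    HasDerivAt (fun t => ∫ z, w z * φ (d z + t * e z) ∂Q)
      (∫ z, w z * (φ' (d z + t * e z) * e z) ∂Q) t := by
  have line (s : ℝ) : MemLp (fun z => d z + s * e z) ⊤ Q := hd.add (he.const_mul s)
  have hφc : Continuous φ := continuous_iff_continuousAt.2 fun x => (hφ x).continuousAt
  obtain ⟨B, hB⟩ := (isCompact_closedBall (0 : ℝ)
    (lpNorm d ⊤ Q + (|t| + 1) * lpNorm e ⊤ Q)).exists_bound_of_continuousOn hφ'.continuousOn
  refine (hasDerivAt_integral_of_dominated_loc_of_deriv_le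
    (F' := fun s z => w z * (φ' (d z + s * e z) * e z))
    (bound := fun z => ‖w z‖ * (B * ‖e z‖)) (Metric.ball_mem_nhds t one_pos)
    (.of_forall fun s => (memLp_top_mul hw (memLp_top_continuous_comp hφc (line s))).1)
    ((memLp_top_mul hw (memLp_top_continuous_comp hφc (line t))).integrable le_top)
    (memLp_top_mul hw (memLp_top_mul (memLp_top_continuous_comp hφ' (line t)) he)).1 ?_
    ((memLp_top_mul hw.norm (he.norm.const_mul B)).integrable le_top)
    (.of_forall fun z s _ => ?_)).2
  · filter_upwards [ae_le_lpNorm_exponent_top hd, ae_le_lpNorm_exponent_top he] with z hdz hez s hs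
    have hs' : |s| ≤ |t| + 1 := by
      have := abs_sub_abs_le_abs_sub s t
      have : |s - t| < 1 := hs
      linarith
    rw [norm_mul, norm_mul]
    gcongr
    refine hB _ (mem_closedBall_zero_iff.2 ((norm_add_le _ _).trans ?_))
    rw [norm_mul]
    gcongr
    exact hs'
  · have := (hφ (d z + s * e z)).comp s (((hasDerivAt_id s).mul_const (e z)).const_add (d z))
    simpa using this.const_mul (w z)

theorem integral_mul_eval_eq_zero {ι : Type*} [Fintype ι] {Y : Ω → ℝ} {X : Ω → ι → ℝ}
    (hY : MemLp Y ⊤ Q) (hX : MemLp X ⊤ Q)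
    (hmoments : ∀ l : List ι, ∫ z, Y z * (l.map (X z)).prod ∂Q = 0) (P : MvPolynomial ι ℝ)
    (l : List ι) : ∫ z, Y z * (l.map (X z)).prod * MvPolynomial.eval (X z) P ∂Q = 0 := by
  induction P using MvPolynomial.induction_on generalizing l with
  | C a => simp only [MvPolynomial.eval_C, integral_mul_const, hmoments, zero_mul]
  | add P P' hP hP' =>
    have list_prod_continuous : Continuous fun x : ι → ℝ => (l.map x).prod :=
      continuous_list_prod l fun i _ => continuous_apply i
    have hint (P : MvPolynomial ι ℝ) : Integrable
        (fun z => Y z * (l.map (X z)).prod * MvPolynomial.eval (X z) P) Q :=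
      (memLp_top_mul (memLp_top_mul hY (memLp_top_continuous_comp list_prod_continuous hX))
        (memLp_top_continuous_comp (MvPolynomial.continuous_eval P) hX)).integrable le_top
    simp only [map_add, mul_add]
    rw [integral_add (hint P) (hint P'), hP, hP', add_zero]
  | mul_X P i hP =>
    rw [← hP (i :: l)]
    simp only [map_mul, MvPolynomial.eval_X, List.map_cons, List.prod_cons]
    exact integral_congr_ae (.of_forall fun z => by ring)

theorem exists_mvPolynomial_near_continuous {ι : Type*} {F : (ι → ℝ) → ℝ} (hF : Continuous F)
    {K : Set (ι → ℝ)} (hK : IsCompact K) {ε : ℝ} (hε : 0 < ε) :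
    ∃ P : MvPolynomial ι ℝ, ∀ x ∈ K, |F x - MvPolynomial.eval x P| < ε := by
  let coord (i : ι) : C(ι → ℝ, ℝ) := ⟨fun x => x i, continuous_apply i⟩
  let A := (MvPolynomial.aeval (R := ℝ) coord).range
  have coord_separates : A.SeparatesPoints := fun x y hxy => by
    obtain ⟨i, hi⟩ := Function.ne_iff.1 hxy
    exact ⟨coord i, ⟨coord i, ⟨MvPolynomial.X i, MvPolynomial.aeval_X _ _⟩, rfl⟩, hi⟩
  have aeval_coord (P : MvPolynomial ι ℝ) (x : ι → ℝ) :
      MvPolynomial.aeval coord P x = MvPolynomial.eval x P := by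
    induction P using MvPolynomial.induction_on <;> simp_all [coord]
  obtain ⟨_, ⟨P, rfl⟩, hP⟩ :=
    ContinuousMap.exists_mem_subalgebra_near_continuous_of_isCompact_of_separatesPoints
      coord_separates ⟨F, hF⟩ hK hε
  refine ⟨P, fun x hx => ?_⟩
  rw [abs_sub_comm, ← aeval_coord]
  exact hP x hx

theorem integral_mul_comp_eq_zero_of_moments {ι : Type*} [Fintype ι] {Y : Ω → ℝ}
    {X : Ω → ι → ℝ} (hY : MemLp Y ⊤ Q) (hX : MemLp X ⊤ Q)
    (hmoments : ∀ l : List ι, ∫ z, Y z * (l.map (X z)).prod ∂Q = 0) {F : (ι → ℝ) → ℝ}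
    (hF : Continuous F) : ∫ z, Y z * F (X z) ∂Q = 0 := by
  have abs_le {ε : ℝ} (hε : 0 < ε) : |∫ z, Y z * F (X z) ∂Q| ≤ (∫ z, |Y z| ∂Q) * ε := by
    obtain ⟨P, hP⟩ := exists_mvPolynomial_near_continuous hF
      (isCompact_closedBall (0 : ι → ℝ) (lpNorm X ⊤ Q)) hε
    have hYF := memLp_top_mul hY (memLp_top_continuous_comp hF hX)
    have hYP := memLp_top_mul hY (memLp_top_continuous_comp (MvPolynomial.continuous_eval P) hX)
    have integral_eq : ∫ z, Y z * F (X z) ∂Q =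
        ∫ z, Y z * (F (X z) - MvPolynomial.eval (X z) P) ∂Q := by
      have hzero := integral_mul_eval_eq_zero hY hX hmoments P []
      simp only [List.map_nil, List.prod_nil, mul_one] at hzero
      simp only [mul_sub]
      rw [integral_sub (hYF.integrable le_top) (hYP.integrable le_top), hzero, sub_zero]
    rw [integral_eq, ← integral_mul_const, ← Real.norm_eq_abs]
    refine norm_integral_le_of_norm_le ((hY.abs.integrable le_top).mul_const ε) ?_
    filter_upwards [ae_le_lpNorm_exponent_top hX] with z hz
    rw [norm_mul]
    exact mul_le_mul_of_nonneg_left (hP _ (mem_closedBall_zero_iff.2 hz)).le (abs_nonneg _)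
  have tendsto_zero : Tendsto (fun ε => (∫ z, |Y z| ∂Q) * ε) (𝓝[>] 0) (𝓝 0) := by
    simpa using (tendsto_id.const_mul (∫ z, |Y z| ∂Q)).mono_left (nhdsWithin_le_nhds (a := (0 : ℝ)))
  exact abs_nonpos_iff.1 (ge_of_tendsto tendsto_zero
    (eventually_mem_nhdsWithin.mono fun _ hε => abs_le hε))

theorem condExp_eq_zero_of_integral_mul_continuous_comp {E : Type*} [NormedAddCommGroup E]
    [NormedSpace ℝ E] [FiniteDimensional ℝ E] [MeasurableSpace E] [BorelSpace E] {Y : Ω → ℝ}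
    {X : Ω → E} (hY : MemLp Y ⊤ Q) (hX : Measurable X)
    (h : ∀ F : E → ℝ, Continuous F → ∫ z, Y z * F (X z) ∂Q = 0) :
    Q[Y | MeasurableSpace.comap X inferInstance] =ᵐ[Q] 0 := by
  obtain ⟨g, hg, hgX⟩ := (stronglyMeasurable_condExp (μ := Q) (f := Y)
    (m := MeasurableSpace.comap X inferInstance)).exists_eq_measurable_comp
  have g_integrable : Integrable g (Q.map X) := by
    rw [integrable_map_measure hg.aestronglyMeasurable hX.aemeasurable, ← hgX]
    exact integrable_condExp
  have g_ae_zero : ∀ᵐ x ∂Q.map X, g x = 0 := by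
    refine ae_eq_zero_of_integral_contDiff_smul_eq_zero g_integrable.locallyIntegrable
      fun F hF hFc => ?_
    obtain ⟨B, hB⟩ := hFc.exists_bound_of_continuous hF.continuous
    have hFX : StronglyMeasurable[MeasurableSpace.comap X inferInstance] fun z => F (X z) :=
      hF.continuous.stronglyMeasurable.comp_measurable (comap_measurable X)
    have hFX' : MemLp (fun z => F (X z)) ⊤ Q :=
      memLp_top_of_bound (hFX.mono hX.comap_le).aestronglyMeasurable B (.of_forall fun z => hB _)
    have hFg : StronglyMeasurable fun x => F x • g x := hF.continuous.stronglyMeasurable.smul hg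
    rw [integral_map hX.aemeasurable hFg.aestronglyMeasurable]
    simp only [smul_eq_mul, ← Function.comp_apply (f := g), ← hgX]
    rw [integral_mul_condExp hX.comap_le hFX hFX' hY]
    simpa only [mul_comm] using h F hF.continuous
  rw [hgX]
  exact ae_of_ae_map hX.aemeasurable g_ae_zero

theorem integral_mul_deriv_comp_eq_zero {φ φ' : ℝ → ℝ} (hφ : ∀ x, HasDerivAt φ (φ' x) x)
    (hφ' : Continuous φ') {w d e : Ω → ℝ} (hw : MemLp w ⊤ Q) (hd : MemLp d ⊤ Q) (he : MemLp e ⊤ Q)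
    {s : Set ℝ} (hs : UniqueDiffWithinAt ℝ s 0) (hs₀ : 0 ∈ s)
    (hzero : ∀ t ∈ s, ∫ z, w z * φ (d z + t * e z) ∂Q = 0) :
    ∫ z, w z * (φ' (d z) * e z) ∂Q = 0 := by
  have h := (hasDerivAt_integral_mul_comp_add_mul hφ hφ' hw hd he 0).hasDerivWithinAt (s := s)
  simp only [zero_mul, add_zero] at h
  exact hs.eq_deriv _ h ((hasDerivWithinAt_const (0 : ℝ) s (0 : ℝ)).congr hzero (hzero 0 hs₀))

theorem integral_mul_list_prod_mul_laplaceMoment_eq_zero {μ : Measure ℝ≥0} [IsFiniteMeasure μ]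
    {T : ℝ} (hT : ∀ᵐ t : ℝ≥0 ∂μ, (t : ℝ) ≤ T) {ι : Type*} [Fintype ι] {Y : Ω → ℝ}
    {D : Ω → ι → ℝ} (hY : MemLp Y ⊤ Q) (hD : MemLp D ⊤ Q) {M : ℝ} (hM : 0 < M)
    (hzero : ∀ b : ι → ℝ, (∀ i, b i ∈ Set.Icc 0 M) →
      ∫ z, Y z * laplaceMoment μ 0 (∑ i, b i * D z i) ∂Q = 0)
    (l : List ι) {b : ι → ℝ} (hb : ∀ i, b i ∈ Set.Icc 0 M) :
    ∫ z, Y z * (l.map (D z)).prod * laplaceMoment μ l.length (∑ i, b i * D z i) ∂Q = 0 := by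
  classical
  induction l generalizing b with
  | nil => simpa using hzero b hb
  | cons j l ih =>
    have hw : MemLp (fun z => Y z * (l.map (D z)).prod) ⊤ Q :=
      memLp_top_mul hY (memLp_top_continuous_comp (F := fun x : ι → ℝ => (l.map x).prod)
        (continuous_list_prod l fun i _ => continuous_apply i) hD)
    have hd : MemLp (fun z => ∑ i, b i * D z i) ⊤ Q :=
      memLp_top_continuous_comp (F := fun x : ι → ℝ => ∑ i, b i * x i) (by fun_prop) hD
    have he : MemLp (fun z => D z j) ⊤ Q := memLp_top_continuous_comp (continuous_apply j) hD
    have hbj := hb j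
    have shift_mem {t : ℝ} (ht : t ∈ Set.Icc (-b j) (M - b j)) (i : ι) :
        (b + Pi.single j t : ι → ℝ) i ∈ Set.Icc 0 M := by
      obtain rfl | hij := eq_or_ne i j
      · simp only [Pi.add_apply, Pi.single_eq_same, Set.mem_Icc]
        constructor <;> linarith [ht.1, ht.2]
      · simpa [hij] using hb i
    have shift_sum (t : ℝ) (z : Ω) :
        ∑ i, (b + Pi.single j t : ι → ℝ) i * D z i = ∑ i, b i * D z i + t * D z j := by
      simp [add_mul, Finset.sum_add_distrib, Pi.single_apply]
    have h := integral_mul_deriv_comp_eq_zero (fun x => (hasDerivAt_laplaceMoment hT l.length x))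
      (continuous_laplaceMoment hT (l.length + 1)).neg hw hd he (s := Set.Icc (-b j) (M - b j))
      (uniqueDiffOn_Icc (by linarith) 0 ⟨by linarith [hbj.1], by linarith [hbj.2]⟩)
      ⟨by linarith [hbj.1], by linarith [hbj.2]⟩ fun t ht => by
        simpa only [shift_sum] using ih (shift_mem ht)
    rw [← neg_eq_zero, ← integral_neg, ← h]
    refine integral_congr_ae (.of_forall fun z => ?_)
    simp only [List.map_cons, List.prod_cons, List.length_cons]
    ring

theorem integral_mul_comp_eq_zero_of_laplaceMoment {μ : Measure ℝ≥0} [IsFiniteMeasure μ]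
    (hμ : 0 < μ (Set.Ioi 0)) {T : ℝ} (hT : ∀ᵐ t : ℝ≥0 ∂μ, (t : ℝ) ≤ T) {ι : Type*} [Fintype ι]
    {Y : Ω → ℝ} {D : Ω → ι → ℝ} (hY : MemLp Y ⊤ Q) (hD : MemLp D ⊤ Q) {M : ℝ} (hM : 0 < M)
    (hzero : ∀ b : ι → ℝ, (∀ i, b i ∈ Set.Icc 0 M) →
      ∫ z, Y z * laplaceMoment μ 0 (∑ i, b i * D z i) ∂Q = 0)
    {F : (ι → ℝ) → ℝ} (hF : Continuous F) : ∫ z, Y z * F (D z) ∂Q = 0 := by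
  refine integral_mul_comp_eq_zero_of_moments hY hD (fun l => ?_) hF
  have h := integral_mul_list_prod_mul_laplaceMoment_eq_zero hT hY hD hM hzero l (b := 0)
    fun _ => ⟨le_rfl, hM.le⟩
  simp only [Pi.zero_apply, zero_mul, Finset.sum_const_zero, integral_mul_const] at h
  exact (mul_eq_zero.1 h).resolve_right (laplaceMoment_pos hT hμ _ 0).ne'

end Moments

section SignalDetection

variable {p : ℕ} {Q : Measure (Sample p)} {S : Finset (Fin p)}

theorem DistributionAssumption.memLp_covariate (hQ : DistributionAssumption Q) :
    MemLp (Prod.fst : Sample p → Fin p → ℝ) ⊤ Q := by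
  obtain ⟨A, _, hA⟩ := hQ.bounded
  refine memLp_top_of_bound measurable_fst.aestronglyMeasurable |A| (hA.mono fun z hz => ?_)
  exact (pi_norm_le_iff_of_nonneg (abs_nonneg A)).2 fun i => (hz.1 i).trans (le_abs_self A)

theorem IsSufficient.isSufficient_empty [IsProbabilityMeasure Q] (hS : IsSufficient Q S)
    (hcent : ∫ z, z.2 ∂Q = 0)
    (hzero : Q[Prod.snd | MeasurableSpace.comap (subvector S) inferInstance] =ᵐ[Q] 0) :
    IsSufficient Q ∅ := by
  have subvector_const : subvector (∅ : Finset (Fin p)) = fun _ => default :=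
    funext fun _ => Subsingleton.elim _ _
  rw [IsSufficient, subvector_const, MeasurableSpace.comap_const, condExp_bot, hcent]
  exact ⟨hS.1.trans hzero, indepFun_const_left _ _⟩

variable {μ : Measure ℝ≥0} [IsFiniteMeasure μ] {q : ℕ} [hq : Fact (q = 1 ∨ q = 2)]

section

variable [IsFiniteMeasure Q] (hμ : 0 < μ (Set.Ioi 0)) {T : ℝ}
  (hT : ∀ᵐ t : ℝ≥0 ∂μ, (t : ℝ) ≤ T) (hX : MemLp (Prod.fst : Sample p → Fin p → ℝ) ⊤ Q)
  (hY : MemLp (Prod.snd : Sample p → ℝ) ⊤ Q) {M : ℝ} (hM : 0 < M)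
  (hzero : ∀ β ∈ feasibleFace S M, ∀ f : KernelSpace μ q p,
    ∫ z, z.2 * f (rescale q β z.1) ∂Q = 0)
include hμ hT hX hY hM hzero

theorem integral_response_mul_comp_distance_eq_zero (y : Fin p → ℝ) {F : (Fin p → ℝ) → ℝ}
    (hF : Continuous F) :
    ∫ z, z.2 * F (S.piecewise (fun i => |y i - z.1 i| ^ q) 0) ∂Q = 0 := by
  have hD : MemLp (fun z : Sample p => S.piecewise (fun i => |y i - z.1 i| ^ q) 0) ⊤ Q := by
    refine memLp_top_continuous_comp
      (F := fun x : Fin p → ℝ => S.piecewise (fun i => |y i - x i| ^ q) (0 : Fin p → ℝ))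
      (continuous_pi fun i => ?_) hX
    by_cases hi : i ∈ S
    · simp only [Finset.piecewise_eq_of_mem _ _ _ hi]
      fun_prop
    · simp only [Finset.piecewise_eq_of_notMem _ _ _ hi]
      fun_prop
  refine integral_mul_comp_eq_zero_of_laplaceMoment hμ hT hY hD hM (fun b hb => ?_) hF
  have hβ : S.piecewise b 0 ∈ feasibleFace S M :=
    piecewise_mem_feasibleFace hM S (by rw [feasibleSet_eq_pi]; exact fun i _ => hb i)
  rw [← hzero _ hβ (kernelFeature μ q (rescale q (S.piecewise b 0) y))]
  have weight_mul (i : Fin p) (d : Fin p → ℝ) :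
      S.piecewise b (0 : Fin p → ℝ) i * d i = b i * S.piecewise d (0 : Fin p → ℝ) i := by
    by_cases hi : i ∈ S <;> simp [hi]
  have nonneg (i : Fin p) : 0 ≤ S.piecewise b (0 : Fin p → ℝ) i := by
    by_cases hi : i ∈ S <;> simp [hi, (hb i).1]
  simp only [kernelFeature_rescale_apply nonneg, weight_mul _ fun i => |y i - _| ^ q]

theorem condExp_response_eq_zero :
    Q[Prod.snd | MeasurableSpace.comap (subvector S) inferInstance] =ᵐ[Q] 0 := by
  refine condExp_eq_zero_of_integral_mul_continuous_comp hY (measurable_subvector S)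
    fun F hF => ?_
  set R := lpNorm (Prod.fst : Sample p → Fin p → ℝ) ⊤ Q
  have hG : Continuous fun u : Fin p → ℝ => F fun i : S => u i ^ (1 / (q : ℝ)) - R :=
    hF.comp (continuous_pi fun i => ((continuous_apply (i : Fin p)).rpow_const
      fun _ => .inr (by positivity)).sub continuous_const)
  rw [← integral_response_mul_comp_distance_eq_zero hμ hT hX hY hM hzero (fun _ => -R) hG]
  refine integral_congr_ae ?_
  filter_upwards [ae_le_lpNorm_exponent_top hX] with z hz
  congr 2
  funext i
  have hi : -R ≤ z.1 i := (abs_le.1 ((norm_le_pi_norm z.1 i).trans hz)).1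
  have distance : |-R - z.1 i| = z.1 i + R := by rw [abs_of_nonpos (by linarith)]; ring
  simp only [Finset.piecewise_eq_of_mem _ _ _ i.2, distance, subvector]
  rw [one_div, Real.pow_rpow_inv_natCast (by linarith) (ne_zero_of_eq_one_or_eq_two hq.out)]
  ring

end

theorem IsSignalSet.exists_integral_response_mul_ne_zero [IsProbabilityMeasure Q]
    (hS : IsSignalSet Q S) (hne : S.Nonempty) (hμ : 0 < μ (Set.Ioi 0)) {T : ℝ}
    (hT : ∀ᵐ t : ℝ≥0 ∂μ, (t : ℝ) ≤ T) (hY : MemLp (Prod.snd : Sample p → ℝ) ⊤ Q)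
    (hQ : DistributionAssumption Q) {M : ℝ} (hM : 0 < M) :
    ∃ β ∈ feasibleFace S M, ∃ f : KernelSpace μ q p,
      ∫ z, z.2 * f (rescale q β z.1) ∂Q ≠ 0 := by
  by_contra! hzero
  have hempty := hS.prop.isSufficient_empty hQ.centered
    (condExp_response_eq_zero hμ hT hQ.memLp_covariate hY hM hzero)
  exact hne.ne_empty (Finset.subset_empty.1 (hS.le_of_le hempty (Finset.empty_subset S)))

section Gain

variable [IsProbabilityMeasure Q] {C : ℝ} (hC : CommonBound μ q Q C) (hcent : ∫ z, z.2 ∂Q = 0)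
  {β : Fin p → ℝ} (f : KernelSpace μ q p)
include hC hcent

theorem le_krrObjective_zero_sub {lam : ℝ} (hlam : 0 < lam) (ε : ℝ) :
    ε * ∫ z, z.2 * f (rescale q β z.1) ∂Q -
        ε ^ 2 / 2 * (∫ z, f (rescale q β z.1) ^ 2 ∂Q + lam * ‖f‖ ^ 2) ≤
      krrObjective μ q Q lam 0 - krrObjective μ q Q lam β := by
  have hY := hC.memLp_response
  have hf : MemLp (fun z : Sample p => f (rescale q β z.1)) ⊤ Q :=
    memLp_top_of_bound ((continuous_kernelSpace hC.mass_le f).measurable.comp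
      ((measurable_rescale q β).comp measurable_fst)).aestronglyMeasurable _
      (.of_forall fun z => abs_apply_le f _)
  have loss_eq : ∫ z, (z.2 - (ε • f) (rescale q β z.1)) ^ 2 ∂Q = ∫ z, z.2 * z.2 ∂Q -
      2 * ε * ∫ z, z.2 * f (rescale q β z.1) ∂Q + ε ^ 2 * ∫ z, f (rescale q β z.1) ^ 2 ∂Q := by
    have hYY := (memLp_top_mul hY hY).integrable le_top
    have hYf := ((memLp_top_mul hY hf).const_mul (2 * ε)).integrable le_top
    have hff := ((memLp_top_mul hf hf).const_mul (ε ^ 2)).integrable le_top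
    have hdiff : Integrable
        (fun z => z.2 * z.2 - 2 * ε * (z.2 * f (rescale q β z.1))) Q := hYY.sub hYf
    simp only [sq (f _)]
    rw [← integral_const_mul, ← integral_const_mul, ← integral_sub hYY hYf,
      ← integral_add hdiff hff]
    refine integral_congr_ae (.of_forall fun z => ?_)
    simp only [RKHS.coe_smul, Pi.smul_apply, smul_eq_mul]
    ring
  have h := krrObjective_le Q hlam.le β (ε • f)
  rw [loss_eq, norm_smul, Real.norm_eq_abs, mul_pow, sq_abs] at h
  rw [krrObjective_zero hC hlam hcent]
  linarith

theorem exists_lt_krrObjective_zero_sub (hf : ∫ z, z.2 * f (rescale q β z.1) ∂Q ≠ 0) :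
    ∃ c₀ > 0, ∀ lam, 0 < lam → lam ≤ 1 →
      c₀ < krrObjective μ q Q lam 0 - krrObjective μ q Q lam β := by
  set b := ∫ z, z.2 * f (rescale q β z.1) ∂Q
  set a := ∫ z, f (rescale q β z.1) ^ 2 ∂Q
  have : 0 ≤ a := integral_nonneg fun z => sq_nonneg _
  set A := a + ‖f‖ ^ 2 + 1
  refine ⟨b ^ 2 / (4 * A), by positivity, fun lam hlam hlam1 => ?_⟩
  have : 0 < A := by positivity
  calc b ^ 2 / (4 * A) < b ^ 2 / (2 * A) := by gcongr; norm_num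
    _ = b / A * b - (b / A) ^ 2 / 2 * A := by field
    _ ≤ b / A * b - (b / A) ^ 2 / 2 * (a + lam * ‖f‖ ^ 2) := by
      have : lam * ‖f‖ ^ 2 ≤ 1 * ‖f‖ ^ 2 := by gcongr
      gcongr
      linarith
    _ ≤ _ := le_krrObjective_zero_sub hC hcent f hlam (b / A)

end Gain

theorem exists_forall_nonempty_levelSet [IsProbabilityMeasure Q] (hμ : KernelAssumption μ)
    (hQ : DistributionAssumption Q) {M : ℝ} (hM : 0 < M) (hS : IsSignalSet Q S)
    (hne : S.Nonempty) :
    ∃ c₀ > 0, ∃ lam₀ > 0, ∀ c δ lam : ℝ, 0 < c → 0 < δ → 0 < lam → c ≤ c₀ → lam ≤ lam₀ →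
      (levelSet S (feasibleSet p M) (krrObjective μ q Q lam) c δ lam).Nonempty := by
  obtain ⟨C, hC⟩ := exists_commonBound hμ q hQ
  obtain ⟨β, hβ, f, hf⟩ := hS.exists_integral_response_mul_ne_zero (q := q) hne hμ.pos hC.mass_le
    hC.memLp_response hQ hM
  obtain ⟨c₀, hc₀, hgain⟩ := exists_lt_krrObjective_zero_sub hC hQ.centered f hf
  refine ⟨c₀, hc₀, 1, one_pos, fun c δ lam hc hδ hlam hcc₀ hlam1 =>
    ⟨β, hβ.1, hcc₀.trans_lt (hgain lam hlam hlam1), ?_⟩⟩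
  rw [Finset.sum_eq_zero fun j hj => by rw [hβ.2 j (Finset.mem_compl.1 hj), abs_zero]]
  positivity

end SignalDetection

end SelfPen

theorem mainTheorem10 {p : ℕ} (q : ℕ) [Fact (q = 1 ∨ q = 2)]
    (μ : Measure ℝ≥0) [IsFiniteMeasure μ] (hμ : KernelAssumption μ)
    (Q : Measure ((Fin p → ℝ) × ℝ)) [IsProbabilityMeasure Q] (hQ : DistributionAssumption Q)
    (M : ℝ) (hM : 0 < M)
    (S : Finset (Fin p)) (hS : IsSignalSet Q S) (hne : S.Nonempty) :
    (∃ c₀ > 0, ∃ lam₀ > 0, ∀ c δ lam : ℝ, 0 < c → 0 < δ → 0 < lam → c ≤ c₀ → lam ≤ lam₀ →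
      (levelSet S (feasibleSet p M) (krrObjective μ q Q lam) c δ lam).Nonempty) ∧
    (∃ δ₀ > 0, ∀ c δ lam : ℝ, 0 < c → 0 < δ → 0 < lam → δ ≤ δ₀ → lam ≤ 1 →
      (levelSet S (feasibleSet p M) (krrObjective μ q Q lam) c δ lam).Nonempty →
      SelfPenalizing S (feasibleSet p M) (krrObjective μ q Q lam)
        (levelSet S (feasibleSet p M) (krrObjective μ q Q lam) c δ lam)) := by
  have : Nonempty (Fin p) := ⟨hne.choose⟩
  exact ⟨exists_forall_nonempty_levelSet hμ hQ hM hS hne,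
    exists_forall_selfPenalizing_levelSet hM hμ hQ hS.prop⟩
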